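/- Let $x,y,z$ be non-negative integers and $a,b,c\in\mathbb{C}\setminus\{0\}$. Put $$A=\begin{bmatrix}a&0\\0&a^{-1}\end{bmatrix},\quad B=\begin{bmatrix}b^{-1}&0\\0&b\end{bmatrix},\quad C=\begin{bmatrix}c&0\\0&c^{-1}\end{bmatrix},\quad L=\begin{bmatrix}0&1\\1&1\end{bmatrix},\quad R=\begin{bmatrix}1&1\\1&0\end{bmatrix},\quad J=\begin{bmatrix}1&0\\0&-1\end{bmatrix},$$ $$\alpha=iAJ,\qquad \beta=iRBLJ,\qquad \gamma=-iLCRJ,$$ so that $\alpha,\beta,\gamma\in SL_2(\mathbb{C})$. **Graph.** The hexagons of the honeycomb graph are indexed by $\mathbb{Z}^3/\mathbb{Z}(1,1,1)$, drawn by projecting $\mathbb{Z}^3$ along $(1,1,1)$ with the third coordinate vector pointing up, the first to the lower left and the second to the lower right; every edge is horizontal, north-east or north-west. The $x\times y\times z$ hexagon graph $H_{x,y,z}$ is the finite induced subgraph on those vertices whose three surrounding hexagons are all indexed by classes of points of $[0,x]\times[0,y]\times[0,z]$ (its perfect matchings correspond to the plane partitions in an $x\times y\times z$ box). **Single dimer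 model.** On $H_{2x,2y,2z}$ call a hexagon even if it is indexed by a class of a point of $(2\mathbb{Z})^3$. Give horizontal, north-east and north-west edges the matrices $A,B,C$ in the following sense. Walk along an edge eastwards, north-eastwards or north-westwards, respectively. If the hexagon on its left is even, its weight is the upper left entry of its matrix; if the hexagon on its right is even, its weight is the lower right entry; if neither is even, its weight is $1$. (The two hexagons beside an edge are never both even.) Let $$Z^{\mathrm{d}}_{2x,2y,2z}(A,B,C)=\sum_{m}\prod_{e\in m}w(e),$$ the sum being over all perfect matchings $m$ of $H_{2x,2y,2z}$. **Double dimer model.** A double dimer configuration on $H_{x,y,z}$ assigns to each edge a multiplicity in $\{0,1,2\}$ such that the multiplicities at each vertex add up to $2$; its edges of multiplicity $1$ form disjoint closed loops. Let the scalar weight be $1$ on every edge, and let the connection $\Gamma$ be $\alpha,\beta,\gamma$ on a step to the east, north-east and north-west, respectively, and $\alpha^{-1},\beta^{-1},\gamma^{-1}$ on the opposite steps. Let $$Z^{\mathrm{dd}}_{x,y,z}(\alpha,\beta,\gamma)=\sum_{D}\ \prod_{\text{closed loops }\ell\text{ of }D}\operatorname{Tr}\Bigl(\prod_{e\in\ell}\Gamma(e)\Bigr),$$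 where the sum is over all double dimer configurations $D$ on $H_{x,y,z}$ and the matrices of each loop are multiplied from right to left in the order in which the loop is traversed (the trace does not depend on the base point and the direction). **Theorem.** $$Z^{\mathrm{d}}_{2x,2y,2z}(A,B,C)=Z^{\mathrm{dd}}_{x,y,z}(\alpha,\beta,\gamma).$$ -/

import Mathlib

open scoped BigOperators

noncomputable section

namespace Squish

/-! ### The single dimer model on a finite graph -/

section Models

variable {V : Type*} [Fintype V]

open Classical in
/-- The dimer partition function: the sum over all perfect matchings `M` of `G` of the product of
the weights of the edges of `M`. -/
def dimerPartition (G : SimpleGraph V) (w : Sym2 V → ℂ) : ℂ :=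
  ∑ M : {M : G.Subgraph // M.IsPerfectMatching}, ∏ e ∈ M.1.edgeSet.toFinset, w e

/-! ### The double dimer model with an `SL₂(ℂ)` connection -/

/-- A double dimer configuration on `G`: each edge is used `0`, `1` or `2` times (`2` is a doubled
edge) and every vertex has degree `2`, counted with multiplicity. -/
structure DoubleDimer (G : SimpleGraph V) where
  mult : Sym2 V → Fin 3
  mult_eq_zero : ∀ e, e ∉ G.edgeSet → mult e = 0
  degree_eq_two : ∀ v, ∑ u, (mult s(v, u) : ℕ) = 2

instance (G : SimpleGraph V) : Finite (DoubleDimer G) :=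
  Finite.of_injective DoubleDimer.mult (by rintro ⟨_, _, _⟩ ⟨_, _, _⟩ h; cases h; rfl)

instance (G : SimpleGraph V) : Fintype (DoubleDimer G) := Fintype.ofFinite _

/-- An `SL₂(ℂ)` connection on `G`: a matrix for each directed edge, where reversing the direction
inverts the matrix. -/
structure SL2Connection {V : Type*} (G : SimpleGraph V) where
  mat : G.Dart → Matrix.SpecialLinearGroup (Fin 2) ℂ
  mat_symm : ∀ d, mat d.symm = (mat d)⁻¹

/-- The product of the connection along a walk; later steps are multiplied on the left. -/
def SL2Connection.monodromy {V : Type*} {G : SimpleGraph V} (Γ : SL2Connection G) {u v : V}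
    (p : G.Walk u v) : Matrix.SpecialLinearGroup (Fin 2) ℂ :=
  (p.darts.map Γ.mat).reverse.prod

open Classical in
/-- `ℓ` is the edge set of a closed loop of `D`, that is, of a cycle all of whose edges have
multiplicity one in `D`. -/
def DoubleDimer.IsLoop {G : SimpleGraph V} (D : DoubleDimer G) (ℓ : Finset (Sym2 V)) : Prop :=
  ∃ (v : V) (p : G.Walk v v), p.IsCycle ∧ (∀ e ∈ p.edges, D.mult e = 1) ∧ p.edges.toFinset = ℓ

/-- The trace of the monodromy around a loop. Two cycles with the same edge set differ by their
base point and their direction only, hence have conjugate or inverse monodromies, and in `SL₂`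
these have the same trace; so the trace does not depend on the cycle that is chosen here. -/
def SL2Connection.loopTrace {G : SimpleGraph V} (Γ : SL2Connection G) {D : DoubleDimer G}
    {ℓ : Finset (Sym2 V)} (h : D.IsLoop ℓ) : ℂ :=
  (Γ.monodromy h.choose_spec.choose : Matrix (Fin 2) (Fin 2) ℂ).trace

open Classical in
/-- The contribution of a double dimer configuration: the product of its edge weights, with
multiplicity, times the product over its closed loops of the traces of the monodromies. -/
def DoubleDimer.contribution {G : SimpleGraph V} (D : DoubleDimer G) (w : Sym2 V → ℂ)
    (Γ : SL2Connection G) : ℂ :=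
  (∏ e : Sym2 V, w e ^ (D.mult e : ℕ)) * ∏ ℓ : {ℓ : Finset (Sym2 V) // D.IsLoop ℓ}, Γ.loopTrace ℓ.2

/-- The double dimer partition function. -/
def doubleDimerPartition (G : SimpleGraph V) (w : Sym2 V → ℂ) (Γ : SL2Connection G) : ℂ :=
  ∑ D : DoubleDimer G, D.contribution w Γ

end Models

/-! ### The honeycomb graph

The centres of the hexagons are the points of the triangular lattice `ℤ³ / ℤ(1,1,1)`; the class of
`(I, J, K)` is written `(I - K, J - K)`. In the picture the third coordinate vector points up, the
first one to the lower left and the second one to the lower right. -/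

/-- Vertices of the honeycomb graph, i.e. triangles of the triangular lattice. `left i j` has the
corners `(i, j)`, `(i+1, j)`, `(i+1, j+1)` and is the left end of a horizontal edge; `right i j` has
the corners `(i, j)`, `(i, j+1)`, `(i+1, j+1)` and is the right end of a horizontal edge. -/
inductive HVertex : Type
  | left (i j : ℤ)
  | right (i j : ℤ)

/-- The centres of the three hexagons around a vertex. -/
def HVertex.corners : HVertex → Set (ℤ × ℤ)
  | .left i j => {(i, j), (i + 1, j), (i + 1, j + 1)}
  | .right i j => {(i, j), (i, j + 1), (i + 1, j + 1)}

/-- The infinite honeycomb graph. Two triangles are adjacent when they share a side. From a left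
vertex the three edges go, in this order, east (horizontal edges), south-west (north-east edges) and
north-west (north-west edges). -/
def honeycomb : SimpleGraph HVertex where
  Adj
    | .left i j, .right k l => (k, l) = (i, j) ∨ (k, l) = (i + 1, j) ∨ (k, l) = (i, j - 1)
    | .right k l, .left i j => (k, l) = (i, j) ∨ (k, l) = (i + 1, j) ∨ (k, l) = (i, j - 1)
    | _, _ => False
  symm := ⟨by rintro (⟨i, j⟩ | ⟨i, j⟩) (⟨k, l⟩ | ⟨k, l⟩) h <;> exact h⟩
  loopless := ⟨by rintro (⟨i, j⟩ | ⟨i, j⟩) h <;> exact h⟩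

/-- The lattice points in the projection of the box `[0, x] × [0, y] × [0, z]`. -/
def boxPoints (x y z : ℕ) : Set (ℤ × ℤ) :=
  {p | ∃ I J K : ℤ, (0 ≤ I ∧ I ≤ x) ∧ (0 ≤ J ∧ J ≤ y) ∧ (0 ≤ K ∧ K ≤ z) ∧ p = (I - K, J - K)}

/-- The vertices of the `x × y × z` honeycomb graph: the triangles in the projection of the box, a
hexagon with side lengths `x, y, z, x, y, z`. -/
def boxVertices (x y z : ℕ) : Set HVertex := {v | v.corners ⊆ boxPoints x y z}

/-- The `x × y × z` honeycomb graph `H_{x,y,z}`. -/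
def hexGraph (x y z : ℕ) : SimpleGraph (boxVertices x y z) := honeycomb.induce (boxVertices x y z)

theorem boxVertices_finite (x y z : ℕ) : (boxVertices x y z).Finite := by
  have hP : (boxPoints x y z).Finite := by
    refine ((Set.finite_Icc (-(z : ℤ)) x).prod (Set.finite_Icc (-(z : ℤ)) y)).subset ?_
    rintro p ⟨I, J, K, hI, hJ, hK, rfl⟩
    simp only [Set.mem_prod, Set.mem_Icc]
    omega
  refine ((hP.image fun p => HVertex.left p.1 p.2).union
    (hP.image fun p => HVertex.right p.1 p.2)).subset ?_
  rintro (⟨i, j⟩ | ⟨i, j⟩) hv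
  · exact Or.inl ⟨(i, j), hv (by simp [HVertex.corners]), rfl⟩
  · exact Or.inr ⟨(i, j), hv (by simp [HVertex.corners]), rfl⟩

instance (x y z : ℕ) : Fintype (boxVertices x y z) := (boxVertices_finite x y z).fintype

/-! ### The matrices -/

def matA (a : ℂˣ) : Matrix (Fin 2) (Fin 2) ℂ := !![(a : ℂ), 0; 0, (a : ℂ)⁻¹]
def matB (b : ℂˣ) : Matrix (Fin 2) (Fin 2) ℂ := !![(b : ℂ)⁻¹, 0; 0, (b : ℂ)]
def matC (c : ℂˣ) : Matrix (Fin 2) (Fin 2) ℂ := !![(c : ℂ), 0; 0, (c : ℂ)⁻¹]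

/-- The transfer matrices for left and right turns, and the matrix `J`. -/
def matL : Matrix (Fin 2) (Fin 2) ℂ := !![0, 1; 1, 1]
def matR : Matrix (Fin 2) (Fin 2) ℂ := !![1, 1; 1, 0]
def matJ : Matrix (Fin 2) (Fin 2) ℂ := !![1, 0; 0, -1]

def alpha (a : ℂˣ) : Matrix.SpecialLinearGroup (Fin 2) ℂ :=
  ⟨Complex.I • (matA a * matJ), by
    simp [matA, matJ, Matrix.det_fin_two]; ring_nf; simp⟩

def beta (b : ℂˣ) : Matrix.SpecialLinearGroup (Fin 2) ℂ :=
  ⟨Complex.I • (matR * matB b * matL * matJ), by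
    rw [Matrix.det_smul]
    simp [matB, matJ, matR, matL, Matrix.det_fin_two]⟩

def gamma (c : ℂˣ) : Matrix.SpecialLinearGroup (Fin 2) ℂ :=
  ⟨(-Complex.I) • (matL * matC c * matR * matJ), by
    rw [Matrix.det_smul]
    simp [matC, matJ, matR, matL, Matrix.det_fin_two]⟩

/-! ### The weights of the single dimer model -/

/-- The weight of an edge that has the hexagon `l` on its left and the hexagon `r` on its right, if
edges of its direction carry the diagonal matrix `M`. The two edges that the squish map identifies
are the one that lies on an even hexagon to its left (the left one of the two parallel edges) and
the one that lies on an even hexagon to its right; they get the first and the second diagonal entry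
of `M`. Edges which lie on no even hexagon get weight `1`. -/
def strandWeight (M : Matrix (Fin 2) (Fin 2) ℂ) (l r : ℤ × ℤ) : ℂ :=
  if Even l.1 ∧ Even l.2 then M 0 0 else if Even r.1 ∧ Even r.2 then M 1 1 else 1

/-- The weight of the edge between the vertices `left i j` and `right k l`. Left and right refer to
walking eastwards, north-eastwards and north-westwards on horizontal, north-east and north-west
edges, respectively. -/
def edgeWeight (A B C : Matrix (Fin 2) (Fin 2) ℂ) (i j k l : ℤ) : ℂ :=
  if (k, l) = (i, j) then strandWeight A (i, j) (i + 1, j + 1)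
  else if (k, l) = (i + 1, j) then strandWeight B (i + 1, j) (i + 1, j + 1)
  else if (k, l) = (i, j - 1) then strandWeight C (i + 1, j) (i, j)
  else 1

def honeycombWeight (A B C : Matrix (Fin 2) (Fin 2) ℂ) : Sym2 HVertex → ℂ :=
  Sym2.lift ⟨fun
    | .left i j, .right k l => edgeWeight A B C i j k l
    | .right k l, .left i j => edgeWeight A B C i j k l
    | _, _ => 1,
    by rintro (⟨i, j⟩ | ⟨i, j⟩) (⟨k, l⟩ | ⟨k, l⟩) <;> rfl⟩

/-- The edge weights on `H_{x,y,z}` given by the diagonal matrices `A` (horizontal edges), `B`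
(north-east edges) and `C` (north-west edges). -/
def hexWeight (x y z : ℕ) (A B C : Matrix (Fin 2) (Fin 2) ℂ) (e : Sym2 (boxVertices x y z)) : ℂ :=
  honeycombWeight A B C (e.map Subtype.val)

/-! ### The connection of the double dimer model -/

/-- The matrix of the step from `u` to `v`: `α`, `β`, `γ` for a step to the east, the north-east and
the north-west, and the inverses for steps in the opposite directions. -/
def stepMatrix (α β γ : Matrix.SpecialLinearGroup (Fin 2) ℂ) :
    HVertex → HVertex → Matrix.SpecialLinearGroup (Fin 2) ℂ
  | .left i j, .right k l =>
      if (k, l) = (i, j) then α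
      else if (k, l) = (i + 1, j) then β⁻¹
      else if (k, l) = (i, j - 1) then γ
      else 1
  | .right k l, .left i j =>
      if (k, l) = (i, j) then α⁻¹
      else if (k, l) = (i + 1, j) then β
      else if (k, l) = (i, j - 1) then γ⁻¹
      else 1
  | _, _ => 1

theorem stepMatrix_symm (α β γ : Matrix.SpecialLinearGroup (Fin 2) ℂ) (u v : HVertex) :
    stepMatrix α β γ v u = (stepMatrix α β γ u v)⁻¹ := by
  rcases u with ⟨i, j⟩ | ⟨i, j⟩ <;> rcases v with ⟨k, l⟩ | ⟨k, l⟩ <;>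
    simp only [stepMatrix, inv_one] <;> split_ifs <;> simp

/-- The connection on `H_{x,y,z}` given by `α`, `β` and `γ`. -/
def hexConnection (x y z : ℕ) (α β γ : Matrix.SpecialLinearGroup (Fin 2) ℂ) :
    SL2Connection (hexGraph x y z) where
  mat d := stepMatrix α β γ d.fst.1 d.snd.1
  mat_symm d := stepMatrix_symm α β γ d.fst.1 d.snd.1

end Squish

end

/-! Cutting every triangle of the triangular lattice into four exhibits the doubled hexagon graph as
`hexGraph x y z` with each vertex replaced by a tripod and each edge by two parallel strands
(`squishIso`). In a perfect matching the centre of a tripod takes one leaf and each of the other two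
leaves uses a strand, so counting strands sends matchings to double dimer configurations. The
identity holds fibre by fibre over this map.

Fix a configuration `D`. A doubled edge carries both its strands, with total weight 1 because the
weight matrices have determinant 1. An edge of an oriented loop carries one strand, and the choices
are free except that consecutive strands must not use the same leaf: a left turn forbids two left
strands in succession, a right turn two right ones. Hence the fibre contributes a product over the
loops of traces of cyclic products of the matrices `L M` and `R M`, where `M` is the diagonal matrix
of the edge (`sum_fiber`, `sum_transfer_eq_prod_trace`).

The matrix `LJ` has order 3 and `RJ = -(LJ)^2`. With the edges coloured by direction in `ZMod 3`, a
left turn adds 1 to the colour and a right turn adds 2. A turn from colour `t` to `t'` therefore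
contributes `(LJ)^(t' - t) J`, with a minus sign at right turns (`transfer_eq_gauge`). Regrouping
cyclically leaves `(LJ)^(-t) J M (LJ)^t` on each edge, which is the given connection up to a factor
`i` or `-i` (`stepMatrix_eq`); these factors alternate around a loop and cancel.

It remains to see that the number `r` of right turns of a loop is even (`LoopParam.prod_turnSign`).
All perfect matchings of a hexagon graph have the same sign as permutations, so an alternating cycle
has an odd number of vertices in each class (`hexGraph_coherent`). By Hall's theorem `D` contains a
perfect matching, and each loop of `D`, of length `2m` say, alternates with respect to it; so `m` is
odd. The left strand of the loop alternates with respect to the doubled matching upstairs. It meets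
one leaf at a left turn, and a leaf, the centre and another leaf at a right turn, so it has `m + r`
vertices in each class. This number is odd too, hence `r` is even. -/

noncomputable section

namespace Squish

/-! ### Perfect matchings of a bipartite graph as involutions -/

/-- Perfect matchings of `G`, as fixed-point-free involutions moving every vertex to a neighbour. -/
def Matching {V : Type*} (G : SimpleGraph V) : Type _ :=
  {f : V → V // (∀ v, G.Adj v (f v)) ∧ Function.Involutive f}

instance {V : Type*} [Finite V] (G : SimpleGraph V) : Finite (Matching G) :=
  inferInstanceAs (Finite {f : V → V // (∀ v, G.Adj v (f v)) ∧ Function.Involutive f})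

instance {V : Type*} [Finite V] (G : SimpleGraph V) : Fintype (Matching G) := Fintype.ofFinite _

/-- The subgraph formed by the edges of a matching. -/
def Matching.toSubgraph {V : Type*} {G : SimpleGraph V} (f : Matching G) : G.Subgraph where
  verts := Set.univ
  Adj a b := f.1 a = b
  adj_sub := by rintro a b rfl; exact f.2.1 a
  edge_vert := fun _ => trivial
  symm := ⟨by rintro a b rfl; exact f.2.2 a⟩

theorem Matching.toSubgraph_isPerfectMatching {V : Type*} {G : SimpleGraph V} (f : Matching G) :
    f.toSubgraph.IsPerfectMatching := by
  rw [SimpleGraph.Subgraph.isPerfectMatching_iff]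
  exact fun v => ⟨f.1 v, rfl, fun w (h : f.1 v = w) => Eq.symm h⟩

theorem Matching.toSubgraph_bijective {V : Type*} (G : SimpleGraph V) :
    Function.Bijective (fun f : Matching G =>
      (⟨f.toSubgraph, f.toSubgraph_isPerfectMatching⟩ :
        {M : G.Subgraph // M.IsPerfectMatching})) := by
  constructor
  · intro f g h
    have h' : f.toSubgraph = g.toSubgraph := congrArg Subtype.val h
    apply Subtype.ext
    funext v
    have : g.toSubgraph.Adj v (f.1 v) := h' ▸ (rfl : f.toSubgraph.Adj v (f.1 v))
    exact Eq.symm this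
  · rintro ⟨M, hM⟩
    have hM' := SimpleGraph.Subgraph.isPerfectMatching_iff.1 hM
    choose f hf hu using hM'
    refine ⟨⟨f, fun v => M.adj_sub (hf v), fun v => (hu _ _ (hf v).symm).symm⟩, ?_⟩
    apply Subtype.ext
    apply SimpleGraph.Subgraph.ext
    · exact (SimpleGraph.Subgraph.isSpanning_iff.1 hM.2).symm
    · funext a b
      apply propext
      exact ⟨fun h => h ▸ hf a, fun h => (hu a b h).symm⟩

/-- The dimer partition function of a bipartite graph as a sum over involutions. -/
theorem dimerPartition_eq_sum_matching {V : Type*} [Fintype V] (G : SimpleGraph V)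
    (w : Sym2 V → ℂ) (side : V → Bool) (hs : ∀ u v, G.Adj u v → side u ≠ side v) :
    dimerPartition G w =
      ∑ f : Matching G, ∏ v ∈ Finset.univ.filter (fun v => side v = true), w s(v, f.1 v) := by
  classical
  unfold dimerPartition
  symm
  apply Fintype.sum_bijective _ (Matching.toSubgraph_bijective G)
  intro f
  refine Finset.prod_bij (fun v _ => s(v, f.1 v)) ?_ ?_ ?_ (fun _ _ => rfl)
  · intro v _
    rw [Set.mem_toFinset]
    exact (rfl : f.toSubgraph.Adj v (f.1 v))
  · intro v hv v' hv' h
    rcases Sym2.eq_iff.1 h with h | h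
    · exact h.1
    · exfalso
      have := hs _ _ (f.2.1 v')
      rw [← h.1] at this
      simp at hv hv'
      exact this (hv'.trans hv.symm)
  · intro e he
    induction e with | _ a b
    rw [Set.mem_toFinset] at he
    have hab : f.1 a = b := he
    have hba : f.1 b = a := by rw [← hab]; exact f.2.2 a
    have := hs _ _ (f.2.1 a)
    rw [hab] at this
    cases ha : side a
    · refine ⟨b, ?_, ?_⟩
      · cases hb : side b <;> simp_all
      · rw [hba, Sym2.eq_swap]
    · exact ⟨a, by simp [ha], by rw [hab]⟩

/-- Matchings can be transported along isomorphisms. -/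
def Matching.congr {V V' : Type*} {G : SimpleGraph V} {G' : SimpleGraph V'} (e : G ≃g G') :
    Matching G ≃ Matching G' where
  toFun f := ⟨fun v => e (f.1 (e.symm v)), fun v => by
    have := e.map_adj_iff.2 (f.2.1 (e.symm v))
    simpa using this, fun v => by simp [f.2.2 (e.symm v)]⟩
  invFun f := ⟨fun v => e.symm (f.1 (e v)), fun v => by
    have := e.symm.map_adj_iff.2 (f.2.1 (e v))
    simpa using this, fun v => by simp [f.2.2 (e v)]⟩
  left_inv f := by apply Subtype.ext; funext v; simp
  right_inv f := by apply Subtype.ext; funext v; simp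

/-- Isomorphic bipartite weighted graphs have the same dimer partition function. -/
theorem dimerPartition_congr {V V' : Type*} [Fintype V] [Fintype V'] {G : SimpleGraph V}
    {G' : SimpleGraph V'} (e : G ≃g G') (w : Sym2 V → ℂ) (w' : Sym2 V' → ℂ) (side' : V' → Bool)
    (hs : ∀ u v, G'.Adj u v → side' u ≠ side' v)
    (hw : ∀ u v, G.Adj u v → w s(u, v) = w' s(e u, e v)) :
    dimerPartition G w = dimerPartition G' w' := by
  classical
  rw [dimerPartition_eq_sum_matching G w (fun v => side' (e v))
    (fun u v h => hs _ _ (e.map_adj_iff.2 h)), dimerPartition_eq_sum_matching G' w' side' hs]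
  apply Fintype.sum_equiv (Matching.congr e)
  intro f
  refine Finset.prod_bij (fun v _ => e v) ?_ ?_ ?_ ?_
  · intro v hv; simpa using hv
  · intro v _ v' _ h; exact e.injective h
  · intro v hv; exact ⟨e.symm v, by simpa using hv, by simp⟩
  · intro v _
    rw [hw _ _ (f.2.1 v)]
    change _ = w' s(e v, e (f.1 (e.symm (e v))))
    rw [e.symm_apply_apply]

/-! ### Inversions and signs of matchings -/

open Classical in
/-- The number of inversions of a map between types ordered by the keys `k` and `k'`. -/
def inversions {α β O : Type*} [Fintype α] [LinearOrder O] (k : α → O) (k' : β → O) (f : α → β) :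
    ℕ :=
  (Finset.univ.filter fun p : α × α => k p.1 < k p.2 ∧ k' (f p.2) < k' (f p.1)).card

/-- A bijection between two different types has no sign of its own; its parity of inversions with
respect to the keys plays that role. -/
theorem sign_mul_neg_one_pow_inversions {α β O : Type*} [Fintype α] [DecidableEq α] [LinearOrder O]
    (k : α → O) (k' : β → O) (hk : Function.Injective k) (hk' : Function.Injective k')
    (f : α → β) (hf : Function.Injective f) (τ : Equiv.Perm α) :
    (-1 : ℤ) ^ inversions k k' (f ∘ τ) = Equiv.Perm.sign τ * (-1 : ℤ) ^ inversions k k' f := by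
  classical
  let : LinearOrder α := LinearOrder.lift' k hk
  have hlt : ∀ a b : α, a < b ↔ k a < k b := fun a b => Iff.rfl
  let e : Fin (Fintype.card α) ≃o α := Fintype.orderIsoFinOfCardEq α rfl
  -- An antisymmetric kernel, equal to 1 or -1 off the diagonal. Its product over the pairs ordered
  -- by `k` is the parity of the inversions, and permuting the arguments of an antisymmetric kernel
  -- multiplies such a product by the sign of the permutation.
  let F : α → α → ℤ := fun a b => if k' (f a) < k' (f b) then 1 else
    if k' (f b) < k' (f a) then -1 else 0
  have hF : ∀ a b, F a b = -F b a := by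
    intro a b
    simp only [F]
    rcases lt_trichotomy (k' (f a)) (k' (f b)) with h | h | h
    · simp [h, h.not_gt]
    · simp [h]
    · simp [h, h.not_gt]
  have key : ∀ σ : Equiv.Perm α,
      ∏ j, ∏ i ∈ Finset.Iio j, F (σ (e i)) (σ (e j)) = (-1 : ℤ) ^ inversions k k' (f ∘ σ) := by
    intro σ
    have h1 : ∏ j, ∏ i ∈ Finset.Iio j, F (σ (e i)) (σ (e j)) =
        ∏ p : Fin (Fintype.card α) × Fin (Fintype.card α),
          if p.1 < p.2 ∧ k' (f (σ (e p.2))) < k' (f (σ (e p.1))) then (-1 : ℤ) else 1 := by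
      rw [Fintype.prod_prod_type, Finset.prod_comm]
      refine Finset.prod_congr rfl fun j _ => ?_
      rw [← Finset.prod_subset (Finset.subset_univ (Finset.Iio j))]
      · refine Finset.prod_congr rfl fun i hi => ?_
        have hij : i < j := Finset.mem_Iio.1 hi
        have hne : k' (f (σ (e i))) ≠ k' (f (σ (e j))) := fun h =>
          hij.ne (e.injective (σ.injective (hf (hk' h))))
        simp only [F, hij, true_and]
        rcases lt_or_gt_of_ne hne with h | h
        · simp [h, h.not_gt]
        · simp [h, h.not_gt]
      · intro i _ hi
        rw [if_neg]
        rintro ⟨h, -⟩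
        exact hi (Finset.mem_Iio.2 h)
    rw [h1, Finset.prod_ite, Finset.prod_const, Finset.prod_const_one, mul_one]
    congr 1
    refine Finset.card_bij (fun p _ => (e p.1, e p.2)) ?_ ?_ ?_
    · intro p hp
      simp only [Finset.mem_filter, Finset.mem_univ, true_and, Function.comp] at hp ⊢
      exact ⟨(hlt _ _).1 (e.lt_iff_lt.2 hp.1), hp.2⟩
    · intro p _ q _ h
      exact Prod.ext (e.injective (congrArg Prod.fst h)) (e.injective (congrArg Prod.snd h))
    · intro p hp
      simp only [Finset.mem_filter, Finset.mem_univ, true_and, Function.comp] at hp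
      refine ⟨(e.symm p.1, e.symm p.2), ?_, by simp⟩
      simp only [Finset.mem_filter, Finset.mem_univ, true_and, e.apply_symm_apply]
      exact ⟨e.symm.lt_iff_lt.2 ((hlt _ _).2 hp.1), hp.2⟩
  have := (e.toEquiv.symm.permCongr τ).prod_Iio_comp_eq_sign_mul_prod
    (f := fun i j => F (e i) (e j)) (fun i j => hF _ _)
  rw [Equiv.Perm.sign_permCongr] at this
  have k1 := key τ
  have k2 := key 1
  simp only [Equiv.Perm.coe_one, id] at k2
  rw [← k1, show inversions k k' f = inversions k k' (f ∘ (1 : Equiv.Perm α)) from rfl, ← key 1]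
  simpa [Equiv.permCongr_apply] using this

open Classical in
/-- The number of points in column `s` that a matching fixes. -/
def fixedCount {α β : Type*} [Fintype α] (k : α → ℤ ×ₗ ℤ) (k' : β → ℤ ×ₗ ℤ) (f : α → β) (s : ℤ) :
    ℕ :=
  (Finset.univ.filter fun a : α => k' (f a) = k a ∧ (ofLex (k a)).1 = s).card

/-- A step keeps the key or lowers the column by one. So the points of `β` in the columns from `s`
on are the images of all points in the columns beyond `s` and of the fixed points of column `s`. The
two cardinalities do not involve `f`, so all matchings have the same fixed counts. -/
theorem fixedCount_add {α β : Type*} [Fintype α] [Fintype β] (k : α → ℤ ×ₗ ℤ) (k' : β → ℤ ×ₗ ℤ)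
    (f : α ≃ β)
    (hstep : ∀ a, k' (f a) = k a ∨ (ofLex (k' (f a))).1 = (ofLex (k a)).1 - 1) (s : ℤ) :
    fixedCount k k' f s + (Finset.univ.filter fun a : α => s < (ofLex (k a)).1).card =
      (Finset.univ.filter fun b : β => s ≤ (ofLex (k' b)).1).card := by
  classical
  unfold fixedCount
  rw [← Finset.card_union_of_disjoint]
  · refine Finset.card_bij (fun a _ => f a) ?_ (fun _ _ _ _ h => f.injective h) ?_
    · intro a ha
      simp only [Finset.mem_union, Finset.mem_filter, Finset.mem_univ, true_and] at ha ⊢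
      rcases ha with ha | ha
      · rw [ha.1, ha.2]
      · rcases hstep a with h | h
        · rw [h]; exact ha.le
        · omega
    · intro b hb
      simp only [Finset.mem_filter, Finset.mem_univ, true_and] at hb
      refine ⟨f.symm b, ?_, by simp⟩
      simp only [Finset.mem_union, Finset.mem_filter, Finset.mem_univ, true_and]
      have h := hstep (f.symm b)
      rw [f.apply_symm_apply] at h ⊢
      rcases h with h | h
      · rw [h] at hb ⊢
        rcases hb.lt_or_eq with h' | h'
        · exact Or.inr h'
        · exact Or.inl ⟨rfl, h'.symm⟩
      · right; omega
  · rw [Finset.disjoint_left]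
    intro a ha ha'
    simp only [Finset.mem_filter, Finset.mem_univ, true_and] at ha ha'
    omega

/-- The inversion number of a matching of a honeycomb region is determined by the numbers of its
horizontal edges in the columns. -/
theorem inversions_eq_sum {α β : Type*} [Fintype α] [Fintype β] (k : α → ℤ ×ₗ ℤ)
    (k' : β → ℤ ×ₗ ℤ) (hk : Function.Injective k) (hk' : Function.Injective k') (f : α ≃ β)
    (hstep : ∀ a, k' (f a) = k a ∨ (ofLex (k' (f a))).1 = (ofLex (k a)).1 - 1)
    (hmono : ∀ a b, (ofLex (k a)).1 = (ofLex (k b)).1 → k a < k b → k' (f a) ≠ k a →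
      k' (f b) ≠ k b → k' (f a) < k' (f b))
    (hcol : ∀ a b, k a = k' b → ∀ i, (∃ a', k a' = toLex ((ofLex (k a)).1, i)) ↔
      (∃ b', k' b' = toLex ((ofLex (k a)).1, i))) (S : Finset ℤ)
    (hS : ∀ a, (ofLex (k a)).1 ∈ S) :
    inversions k k' f = ∑ s ∈ S, fixedCount k k' f s *
      ((Finset.univ.filter fun a : α => (ofLex (k a)).1 = s).card - fixedCount k k' f s) := by
  classical
  have hexL : ∀ a b (c : ℤ ×ₗ ℤ), k a = k' b → (ofLex c).1 = (ofLex (k a)).1 →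
      ((∃ a', k a' = c) ↔ ∃ b', k' b' = c) := by
    intro a b c hab hc
    have := hcol a b hab (ofLex c).2
    rw [← hc] at this
    exact this
  have h1 : inversions k k' f = (Finset.univ.filter fun p : α × α =>
      (ofLex (k p.1)).1 = (ofLex (k p.2)).1 ∧ k' (f p.1) = k p.1 ∧ k' (f p.2) ≠ k p.2).card := by
    unfold inversions
    -- Lower columns come first. Two fixed points keep their order, two moved points do by `hmono`
    -- and the common shift by one column, and a moved point in front of a fixed one only moves
    -- further to the front. So an inversion has a fixed first and a moved second entry, and a shift
    -- by one column cannot overtake more than that.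
    have hinv : ∀ a b : α, k a < k b → k' (f b) < k' (f a) → k' (f a) = k a ∧ k' (f b) ≠ k b ∧
        ((ofLex (k b)).1 = (ofLex (k a)).1 ∨ (ofLex (k b)).1 = (ofLex (k a)).1 + 1) := by
      intro a b h1 h2
      have ha := hstep a
      have hb := hstep b
      have hm := hmono a b
      have hm' := hm
      by_cases haH : k' (f a) = k a
      · refine ⟨haH, ?_, ?_⟩
        · intro hbH
          rw [haH, hbH] at h2
          exact lt_asymm h1 h2
        · rw [haH] at h2
          rw [Prod.Lex.lt_iff] at h1 h2
          have hbH : k' (f b) ≠ k b := by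
            intro hbH
            rw [hbH] at h2
            omega
          have := hb.resolve_left hbH
          omega
      · exfalso
        have ha' := ha.resolve_left haH
        by_cases hbH : k' (f b) = k b
        · rw [hbH] at h2
          rw [Prod.Lex.lt_iff] at h1 h2
          omega
        · have hb' := hb.resolve_left hbH
          by_cases hs : (ofLex (k a)).1 = (ofLex (k b)).1
          · exact lt_asymm h2 (hm hs h1 haH hbH)
          · rw [Prod.Lex.lt_iff] at h1 h2
            omega
    -- the partner of an inversion in the column of its first entry
    have hpart : ∀ a b : α, k a < k b → k' (f b) < k' (f a) →
        (ofLex (k b)).1 = (ofLex (k a)).1 + 1 → ∃ c, k c = k' (f b) := by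
      intro a b h1 h2 h3
      obtain ⟨haH, hbH, -⟩ := hinv a b h1 h2
      refine (hexL a (f a) (k' (f b)) haH.symm ?_).2 ⟨_, rfl⟩
      have := (hstep b).resolve_left hbH
      omega
    choose g hg using hpart
    -- A second entry in the next column is replaced by the point in the column of the first entry
    -- whose key is that of its image. The replaced pairs are those whose second entry precedes the
    -- first, the unchanged ones those where it follows.
    refine Finset.card_bij (fun p hp => if h : (ofLex (k p.2)).1 = (ofLex (k p.1)).1 + 1 then
      (p.1, g p.1 p.2 (Finset.mem_filter.1 hp).2.1 (Finset.mem_filter.1 hp).2.2 h) else p) ?_ ?_ ?_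
    · rintro ⟨a, b⟩ hp
      have hp' := (Finset.mem_filter.1 hp).2
      obtain ⟨haH, hbH, hc⟩ := hinv a b hp'.1 hp'.2
      simp only
      split_ifs with h
      · have hgg := hg a b hp'.1 hp'.2 h
        have hb := (hstep b).resolve_left hbH
        simp only [Finset.mem_filter, Finset.mem_univ, true_and]
        refine ⟨?_, haH, ?_⟩
        · rw [hgg]; omega
        · intro h'
          rw [hgg] at h'
          have := f.injective (hk' h')
          rw [this] at hgg
          exact hbH hgg.symm
      · simp only [Finset.mem_filter, Finset.mem_univ, true_and]
        exact ⟨(hc.resolve_right h).symm, haH, hbH⟩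
    · rintro ⟨a, b⟩ hp ⟨a', b'⟩ hp' heq
      have q := (Finset.mem_filter.1 hp).2
      have q' := (Finset.mem_filter.1 hp').2
      obtain ⟨haH, hbH, hc⟩ := hinv a b q.1 q.2
      obtain ⟨haH', hbH', hc'⟩ := hinv a' b' q'.1 q'.2
      simp only at q q' heq
      split_ifs at heq with h h' h'
      · have e1 := congrArg Prod.fst heq
        have e2 := congrArg Prod.snd heq
        simp only at e1 e2
        subst e1
        have g1 := hg a b q.1 q.2 h
        have g2 := hg a b' q'.1 q'.2 h'
        rw [e2] at g1
        rw [f.injective (hk' (g1.symm.trans g2))]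
      · have e1 := congrArg Prod.fst heq
        have e2 := congrArg Prod.snd heq
        simp only at e1 e2
        subst e1
        have g1 := hg a b q.1 q.2 h
        rw [e2] at g1
        exfalso
        have := q.2
        rw [← g1, haH] at this
        exact lt_asymm this q'.1
      · have e1 := congrArg Prod.fst heq
        have e2 := congrArg Prod.snd heq
        simp only at e1 e2
        subst e1
        have g1 := hg a b' q'.1 q'.2 h'
        rw [← e2] at g1
        exfalso
        have := q'.2
        rw [← g1, haH] at this
        exact lt_asymm this q.1
      · exact heq
    · rintro ⟨a, b⟩ hp
      simp only [Finset.mem_filter, Finset.mem_univ, true_and] at hp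
      obtain ⟨hs, haH, hbH⟩ := hp
      have hne : k a ≠ k b := by
        intro h
        have := hk h
        subst this
        exact hbH haH
      rcases lt_or_gt_of_ne hne with hlt | hlt
      · have h2 : k' (f b) < k' (f a) := by
          rw [haH, Prod.Lex.lt_iff]
          have := (hstep b).resolve_left hbH
          omega
        refine ⟨(a, b), by simpa using ⟨hlt, h2⟩, ?_⟩
        rw [dif_neg]
        simp only
        omega
      -- Here `b` precedes `a`. The column has a fixed point, so by `hcol` some `r` has the key of
      -- `b`. As `b` is moved, `r` is matched from the next column, and its partner there forms an
      -- inversion with `a`.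
      · obtain ⟨r, hr⟩ := (hexL a (f a) (k b) haH.symm hs.symm).1 ⟨b, rfl⟩
        have hc := hstep (f.symm r)
        rw [f.apply_symm_apply, hr] at hc
        have hnr : k b ≠ k (f.symm r) := by
          intro h
          apply hbH
          rw [hk h, f.apply_symm_apply, hr, h]
        have hc := hc.resolve_left hnr
        have h1 : k a < k (f.symm r) := by
          rw [Prod.Lex.lt_iff]; omega
        have h2 : k' (f (f.symm r)) < k' (f a) := by
          rw [f.apply_symm_apply, hr, haH]; exact hlt
        refine ⟨(a, f.symm r), by simpa using ⟨h1, by simpa using h2⟩, ?_⟩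
        have h3 : (ofLex (k (f.symm r))).1 = (ofLex (k a)).1 + 1 := by omega
        rw [dif_pos h3]
        refine Prod.ext rfl (hk ?_)
        rw [hg a (f.symm r) h1 h2 h3, f.apply_symm_apply, hr]
  rw [h1, Finset.card_eq_sum_card_fiberwise (f := fun p => (ofLex (k p.1)).1) (t := S)
    (fun p _ => hS _)]
  refine Finset.sum_congr rfl fun s _ => ?_
  have h2 : (Finset.univ.filter fun a : α => (ofLex (k a)).1 = s).card - fixedCount k k' f s =
      (Finset.univ.filter fun a : α => k' (f a) ≠ k a ∧ (ofLex (k a)).1 = s).card := by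
    unfold fixedCount
    rw [← Finset.card_sdiff_of_subset]
    · congr 1
      ext a
      simp only [Finset.mem_sdiff, Finset.mem_filter, Finset.mem_univ, true_and]
      tauto
    · intro a
      simp only [Finset.mem_filter, Finset.mem_univ, true_and]
      tauto
  rw [h2]
  unfold fixedCount
  rw [← Finset.card_product]
  congr 1
  ext ⟨a, b⟩
  simp only [Finset.mem_filter, Finset.mem_univ, true_and, Finset.mem_product]
  constructor
  · rintro ⟨⟨h, h', h''⟩, h3⟩
    exact ⟨⟨h', h3⟩, h'', h ▸ h3⟩
  · rintro ⟨⟨h, h'⟩, h'', h3⟩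
    exact ⟨⟨h'.trans h3.symm, h, h''⟩, h'⟩

/-- All matchings of a honeycomb region induce permutations of the same sign. -/
theorem sign_eq_one_of_columns {α β : Type*} [Fintype α] [Fintype β] [DecidableEq α]
    (k : α → ℤ ×ₗ ℤ)
    (k' : β → ℤ ×ₗ ℤ) (hk : Function.Injective k) (hk' : Function.Injective k')
    (hcol : ∀ a b, k a = k' b → ∀ i, (∃ a', k a' = toLex ((ofLex (k a)).1, i)) ↔
      (∃ b', k' b' = toLex ((ofLex (k a)).1, i)))
    (adj : α → β → Prop)
    (hadj : ∀ a b, adj a b → k' b = k a ∨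
      (ofLex (k' b)).1 = (ofLex (k a)).1 - 1 ∧
        ((ofLex (k' b)).2 = (ofLex (k a)).2 ∨ (ofLex (k' b)).2 = (ofLex (k a)).2 + 1))
    (f : α ≃ β) (τ : Equiv.Perm α) (hf : ∀ a, adj a (f a)) (hg : ∀ a, adj a (f (τ a))) :
    Equiv.Perm.sign τ = 1 := by
  classical
  have hmono : ∀ g : α ≃ β, (∀ a, adj a (g a)) → ∀ a b, (ofLex (k a)).1 = (ofLex (k b)).1 →
      k a < k b → k' (g a) ≠ k a → k' (g b) ≠ k b → k' (g a) < k' (g b) := by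
    intro g hg a b hs hlt ha hb
    obtain ⟨a1, a2⟩ := (hadj _ _ (hg a)).resolve_left ha
    obtain ⟨b1, b2⟩ := (hadj _ _ (hg b)).resolve_left hb
    have hne : k' (g a) ≠ k' (g b) := fun h => by
      have := g.injective (hk' h)
      rw [this] at hlt
      exact lt_irrefl _ hlt
    refine lt_of_le_of_ne ?_ hne
    rw [Prod.Lex.le_iff]
    rw [Prod.Lex.lt_iff] at hlt
    omega
  have hst : ∀ g : α ≃ β, (∀ a, adj a (g a)) → ∀ a, k' (g a) = k a ∨
      (ofLex (k' (g a))).1 = (ofLex (k a)).1 - 1 :=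
    fun g hg a => (hadj _ _ (hg a)).imp id And.left
  have e1 := inversions_eq_sum k k' hk hk' f (hst f hf) (hmono f hf) hcol
    (Finset.univ.image fun a => (ofLex (k a)).1) (by simp)
  have e2 := inversions_eq_sum k k' hk hk' (τ.trans f) (hst (τ.trans f) hg) (hmono (τ.trans f) hg)
    hcol (Finset.univ.image fun a => (ofLex (k a)).1) (by simp)
  have e3 : ∀ s, fixedCount k k' f s = fixedCount k k' (τ.trans f) s := by
    intro s
    have h1 := fixedCount_add k k' f (hst f hf) s
    have h2 := fixedCount_add k k' (τ.trans f) (hst (τ.trans f) hg) s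
    omega
  simp only [← e3] at e2
  have e4 := sign_mul_neg_one_pow_inversions k k' hk hk' f f.injective τ
  rw [show (f ∘ τ : α → β) = (τ.trans f : α ≃ β) from rfl, e2.trans e1.symm] at e4
  rcases Int.units_eq_one_or (Equiv.Perm.sign τ) with h | h
  · exact h
  · rw [h] at e4
    have : (-1 : ℤ) ^ inversions k k' f ≠ 0 := by positivity
    simp at e4
    omega

/-! ### Cycles that alternate with respect to a perfect matching -/

/-- In a coherent bipartite graph every cycle that alternates with respect to a perfect matching
passes through an odd number of left vertices. The list `l` consists of the left vertices of such a
cycle, in cyclic order. -/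
def Coherent {V : Type*} (G : SimpleGraph V) (side : V → Bool) : Prop :=
  ∀ (f : Matching G) (l : List V) (hl : l ≠ []), l.Nodup → (∀ v ∈ l, side v = true) →
    l.IsChain (fun a b => G.Adj a (f.1 b)) → G.Adj (l.getLast hl) (f.1 (l.head hl)) → Odd l.length

theorem Coherent.congr {V V' : Type*} {G : SimpleGraph V} {G' : SimpleGraph V'} (e : G ≃g G')
    {side' : V' → Bool} (h : Coherent G' side') : Coherent G (fun v => side' (e v)) := by
  intro f l hl hnd hside hch hclose
  have h1 := h (Matching.congr e f) (l.map e) (by simpa using hl) (hnd.map e.injective)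
    (by simpa using hside) ?_ ?_
  · simpa using h1
  · rw [List.isChain_map]
    refine hch.imp fun a b hab => ?_
    change G'.Adj (e a) (e (f.1 (e.symm (e b))))
    rw [e.symm_apply_apply]
    exact e.map_adj_iff.2 hab
  · rw [List.getLast_map, List.head_map]
    change G'.Adj (e _) (e (f.1 (e.symm (e _))))
    rw [e.symm_apply_apply]
    exact e.map_adj_iff.2 hclose

/-- A graph is coherent if all its perfect matchings have the same sign. -/
theorem coherent_of_sign {V : Type*} [Fintype V] {G : SimpleGraph V} {side : V → Bool}
    [DecidableEq {v // side v = true}]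
    (hs : ∀ u v, G.Adj u v → side u ≠ side v)
    (h : ∀ (f : {v // side v = true} ≃ {v // side v = false}) (τ : Equiv.Perm {v // side v = true}),
      (∀ a, G.Adj a.1 (f a).1) → (∀ a, G.Adj a.1 (f (τ a)).1) → Equiv.Perm.sign τ = 1) :
    Coherent G side := by
  intro f l hl hnd hside hch hclose
  have hL : ∀ v, side v = true → side (f.1 v) = false := fun v hv => by
    have := hs _ _ (f.2.1 v)
    rw [hv] at this
    simpa using this
  have hR : ∀ v, side v = false → side (f.1 v) = true := fun v hv => by
    have := hs _ _ (f.2.1 v)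
    rw [hv] at this
    simpa using this
  let φ : {v // side v = true} ≃ {v // side v = false} :=
    { toFun := fun a => ⟨f.1 a.1, hL _ a.2⟩
      invFun := fun a => ⟨f.1 a.1, hR _ a.2⟩
      left_inv := fun a => Subtype.ext (f.2.2 a.1)
      right_inv := fun a => Subtype.ext (f.2.2 a.1) }
  obtain ⟨n, hn⟩ : ∃ n, l.length = n + 1 :=
    ⟨l.length - 1, by have := List.length_pos_iff.2 hl; omega⟩
  let w : Fin (n + 1) ↪ {v // side v = true} :=
    ⟨fun i => ⟨l[i.1]'(by omega), hside _ (List.getElem_mem _)⟩, fun i j hij => by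
      have := congrArg Subtype.val hij
      exact Fin.ext ((hnd.getElem_inj_iff).1 this)⟩
  -- Shifting the left vertices of the cycle by one step gives a second perfect matching. It differs
  -- from the first by a cycle of length `n + 1`, whose sign `(-1) ^ n` must be 1.
  have hsgn := h φ ((finRotate (n + 1)).viaFintypeEmbedding w) (fun a => f.2.1 a.1) ?_
  · rw [Equiv.Perm.viaFintypeEmbedding_sign, sign_finRotate] at hsgn
    rw [hn]
    have : Even (n + 1 - 1) := by
      by_contra hodd
      rw [Nat.not_even_iff_odd] at hodd
      rw [hodd.neg_one_pow] at hsgn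
      exact absurd hsgn (by decide)
    simpa using this.add_one
  · intro a
    by_cases ha : a ∈ Set.range w
    · obtain ⟨i, rfl⟩ := ha
      rw [Equiv.Perm.viaFintypeEmbedding_apply_image]
      change G.Adj (l[i.1]'_) (f.1 (l[(finRotate (n + 1) i).1]'_))
      by_cases hi : i.1 < n
      · have h1 : (finRotate (n + 1) i).1 = i.1 + 1 := by
          rw [coe_finRotate_of_ne_last]
          intro h; rw [h] at hi; simp at hi
        simp only [h1]
        exact List.isChain_iff_getElem.1 hch i.1 (by omega)
      · have hi' : i = Fin.last n := Fin.ext (by simp; omega)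
        subst hi'
        have h1 : (finRotate (n + 1) (Fin.last n)).1 = 0 := by simp
        simp only [h1, Fin.val_last]
        convert hclose using 2
        · rw [List.getLast_eq_getElem]
          congr 1
          omega
        · rw [List.head_eq_getElem]
    · rw [Equiv.Perm.viaFintypeEmbedding_apply_notMem_range _ _ ha]
      exact f.2.1 a.1

/-! ### Coherence of the honeycomb regions -/

/-- The bipartition of the honeycomb graph. -/
def hexSide : HVertex → Bool
  | .left _ _ => true
  | .right _ _ => false

theorem honeycomb_side (u v : HVertex) (h : honeycomb.Adj u v) : hexSide u ≠ hexSide v := by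
  rcases u with ⟨i, j⟩ | ⟨i, j⟩ <;> rcases v with ⟨k, l⟩ | ⟨k, l⟩ <;>
    simp_all [honeycomb, hexSide]

/-- The column of a vertex and its position in the column. -/
def hexKey : HVertex → ℤ ×ₗ ℤ
  | .left i j => toLex (j - i, i)
  | .right i j => toLex (j - i, i)

theorem mem_boxPoints_iff (x y z : ℕ) (p q : ℤ) : (p, q) ∈ boxPoints x y z ↔
    -(z : ℤ) ≤ p ∧ p ≤ x ∧ -(z : ℤ) ≤ q ∧ q ≤ y ∧ -(y : ℤ) ≤ p - q ∧ p - q ≤ x := by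
  constructor
  · rintro ⟨I, J, K, hI, hJ, hK, h⟩
    simp only [Prod.mk.injEq] at h
    omega
  · rintro h
    -- The representative of the class whose least coordinate is 0.
    refine ⟨p + max 0 (max (-p) (-q)), q + max 0 (max (-p) (-q)), max 0 (max (-p) (-q)),
      ?_, ?_, ?_, ?_⟩
    · omega
    · omega
    · omega
    · simp

theorem left_mem_boxVertices (x y z : ℕ) (i j : ℤ) : HVertex.left i j ∈ boxVertices x y z ↔
    -(z : ℤ) ≤ i ∧ i + 1 ≤ x ∧ -(z : ℤ) ≤ j ∧ j + 1 ≤ y ∧ -(y : ℤ) ≤ i - j ∧ i + 1 - j ≤ x := by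
  simp only [boxVertices, HVertex.corners, Set.mem_ofPred_eq, Set.insert_subset_iff,
    Set.singleton_subset_iff, mem_boxPoints_iff]
  omega

theorem right_mem_boxVertices (x y z : ℕ) (i j : ℤ) : HVertex.right i j ∈ boxVertices x y z ↔
    -(z : ℤ) ≤ i ∧ i + 1 ≤ x ∧ -(z : ℤ) ≤ j ∧ j + 1 ≤ y ∧ -(y : ℤ) ≤ i - j - 1 ∧ i - j ≤ x := by
  simp only [boxVertices, HVertex.corners, Set.mem_ofPred_eq, Set.insert_subset_iff,
    Set.singleton_subset_iff, mem_boxPoints_iff]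
  omega

theorem hexGraph_side (x y z : ℕ) (u v : boxVertices x y z) (h : (hexGraph x y z).Adj u v) :
    hexSide u.1 ≠ hexSide v.1 :=
  honeycomb_side _ _ h

/-- In terms of `hexKey`, a horizontal edge joins equal keys, while the other two edges at a left
vertex lower the column by one and keep the position or raise it by one. In a column with a key
shared by a left and a right vertex, both kinds occupy the same positions. -/
theorem hexGraph_coherent (x y z : ℕ) :
    Coherent (hexGraph x y z) (fun v => hexSide v.1) := by
  classical
  refine coherent_of_sign (hexGraph_side x y z) fun f τ hf hg => ?_
  refine sign_eq_one_of_columns (fun a => hexKey a.1.1) (fun b => hexKey b.1.1) ?_ ?_ ?_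
    (fun a b => (hexGraph x y z).Adj a.1 b.1) ?_ f τ hf hg
  · rintro ⟨⟨⟨i, j⟩ | ⟨i, j⟩, h⟩, hs⟩ ⟨⟨⟨k, l⟩ | ⟨k, l⟩, h'⟩, hs'⟩ heq <;>
      simp only [hexSide, hexKey, Bool.false_eq_true, toLex_inj, Prod.mk.injEq] at hs hs' heq
    simp only [Subtype.mk.injEq, HVertex.left.injEq]
    omega
  · rintro ⟨⟨⟨i, j⟩ | ⟨i, j⟩, h⟩, hs⟩ ⟨⟨⟨k, l⟩ | ⟨k, l⟩, h'⟩, hs'⟩ heq <;>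
      simp only [hexSide, hexKey, Bool.true_eq_false, toLex_inj, Prod.mk.injEq] at hs hs' heq
    simp only [Subtype.mk.injEq, HVertex.right.injEq]
    omega
  · rintro ⟨⟨⟨i, j⟩ | ⟨i, j⟩, h⟩, hs⟩ ⟨⟨⟨k, l⟩ | ⟨k, l⟩, h'⟩, hs'⟩ heq m <;>
      simp only [hexSide, hexKey, Bool.true_eq_false, Bool.false_eq_true, toLex_inj,
        Prod.mk.injEq] at hs hs' heq
    rw [left_mem_boxVertices] at h
    rw [right_mem_boxVertices] at h'
    constructor
    · rintro ⟨⟨⟨⟨p, q⟩ | ⟨p, q⟩, h2⟩, hs2⟩, h3⟩ <;>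
        simp only [hexSide, hexKey, Bool.false_eq_true, toLex_inj, Prod.mk.injEq, ofLex_toLex]
          at hs2 h3
      rw [left_mem_boxVertices] at h2
      refine ⟨⟨⟨.right p q, ?_⟩, rfl⟩, ?_⟩
      · rw [right_mem_boxVertices]; omega
      · simp only [hexKey, toLex_inj, Prod.mk.injEq, ofLex_toLex]
        exact h3
    · rintro ⟨⟨⟨⟨p, q⟩ | ⟨p, q⟩, h2⟩, hs2⟩, h3⟩ <;>
        simp only [hexSide, hexKey, Bool.true_eq_false, toLex_inj, Prod.mk.injEq, ofLex_toLex]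
          at hs2 h3
      rw [right_mem_boxVertices] at h2
      refine ⟨⟨⟨.left p q, ?_⟩, rfl⟩, ?_⟩
      · rw [left_mem_boxVertices]; omega
      · simp only [hexKey, toLex_inj, Prod.mk.injEq, ofLex_toLex]
        exact h3
  · rintro ⟨⟨⟨i, j⟩ | ⟨i, j⟩, h⟩, hs⟩ ⟨⟨⟨k, l⟩ | ⟨k, l⟩, h'⟩, hs'⟩ hadj <;>
      simp only [hexSide, Bool.true_eq_false, Bool.false_eq_true] at hs hs'
    have hadj' : (k, l) = (i, j) ∨ (k, l) = (i + 1, j) ∨ (k, l) = (i, j - 1) := hadj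
    simp only [Prod.mk.injEq] at hadj'
    simp only [hexKey, toLex_inj, Prod.mk.injEq, ofLex_toLex]
    omega

/-! ### Traces of cyclic matrix products -/

/-- The product `X (n - 1) * ⋯ * X 1 * X 0`. -/
def orderedProd {R : Type*} [Monoid R] (X : ℕ → R) (n : ℕ) : R :=
  ((List.range n).map X).reverse.prod

@[simp]
theorem orderedProd_zero {R : Type*} [Monoid R] (X : ℕ → R) : orderedProd X 0 = 1 := rfl

theorem orderedProd_succ {R : Type*} [Monoid R] (X : ℕ → R) (n : ℕ) :
    orderedProd X (n + 1) = X n * orderedProd X n := by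
  simp [orderedProd, List.range_succ]

/-- The arbitrary weight `h` on the two ends makes the induction work, since the last matrix can be
absorbed into it. A closing factor is a special choice of `h`. -/
theorem sum_paths {ι R : Type*} [Fintype ι] [DecidableEq ι] [CommRing R] (X : ℕ → Matrix ι ι R) (n : ℕ)
    (h : ι → ι → R) :
    ∑ s : Fin (n + 1) → ι, h (s 0) (s (Fin.last n)) *
        ∏ i : Fin n, X i (s i.succ) (s i.castSucc) =
      ∑ b, ∑ a, h b a * orderedProd X n a b := by
  induction n generalizing h with
  | zero =>
    rw [← (Equiv.funUnique (Fin 1) ι).symm.sum_comp]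
    simp [Matrix.one_apply]
  | succ n ih =>
    rw [← (Fin.snocEquiv (fun _ => ι)).sum_comp, Fintype.sum_prod_type, Finset.sum_comm]
    obtain ⟨h', hh'⟩ : ∃ h' : ι → ι → R, ∀ b a, h' b a = ∑ c, h b c * X n c a := ⟨_, fun _ _ => rfl⟩
    have h1 : ∀ s : Fin (n + 1) → ι, ∑ c, h ((Fin.snocEquiv (fun _ => ι)) (c, s) 0)
        ((Fin.snocEquiv (fun _ => ι)) (c, s) (Fin.last (n + 1))) *
        ∏ i : Fin (n + 1), X i ((Fin.snocEquiv (fun _ => ι)) (c, s) i.succ)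
          ((Fin.snocEquiv (fun _ => ι)) (c, s) i.castSucc) =
        h' (s 0) (s (Fin.last n)) * ∏ i : Fin n, X i (s i.succ) (s i.castSucc) := by
      intro s
      simp only [hh', Finset.sum_mul]
      refine Finset.sum_congr rfl fun c _ => ?_
      rw [Fin.prod_univ_castSucc]
      have e0 : (Fin.snocEquiv (fun _ => ι)) (c, s) 0 = s 0 := by
        change Fin.snoc (α := fun _ => ι) s c (Fin.castSucc 0) = s 0
        rw [Fin.snoc_castSucc]
      have e1 : (Fin.snocEquiv (fun _ => ι)) (c, s) (Fin.last (n + 1)) = c := by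
        change Fin.snoc (α := fun _ => ι) s c _ = c
        rw [Fin.snoc_last]
      have e2 : ∀ i : Fin (n + 1), (Fin.snocEquiv (fun _ => ι)) (c, s) i.castSucc = s i := by
        intro i
        change Fin.snoc (α := fun _ => ι) s c _ = s i
        rw [Fin.snoc_castSucc]
      simp only [Fin.succ_castSucc, Fin.succ_last, e0, e1, e2, Fin.val_castSucc, Fin.val_last]
      ring
    refine (Finset.sum_congr rfl fun s _ => h1 s).trans ((ih h').trans ?_)
    refine Finset.sum_congr rfl fun b _ => ?_
    simp only [hh', orderedProd_succ, Matrix.mul_apply, Finset.mul_sum, Finset.sum_mul]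
    rw [Finset.sum_comm]
    refine Finset.sum_congr rfl fun c _ => Finset.sum_congr rfl fun a _ => ?_
    ring

/-- The trace of a cyclic product as a sum over closed paths of indices. -/
theorem trace_orderedProd {ι R : Type*} [Fintype ι] [DecidableEq ι] [CommRing R] (n : ℕ) [NeZero n]
    (Y : ZMod n → Matrix ι ι R) :
    (orderedProd (fun k => Y k) n).trace = ∑ s : ZMod n → ι, ∏ k, Y k (s (k + 1)) (s k) := by
  obtain ⟨m, rfl⟩ : ∃ m, n = m + 1 := ⟨n - 1, by have := NeZero.pos n; omega⟩
  rw [orderedProd_succ, Matrix.trace]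
  -- The last matrix closes the path and serves as the weight on its ends.
  have h := sum_paths (fun k => Y k) m (fun b a => Y m b a)
  simp only [Matrix.diag, Matrix.mul_apply]
  rw [← h]
  change ∑ s : Fin (m + 1) → ι, _ = ∑ s : Fin (m + 1) → ι, _
  refine Finset.sum_congr rfl fun s _ => ?_
  change _ = ∏ k : Fin (m + 1), _
  rw [Fin.prod_univ_castSucc, mul_comm]
  congr 1
  · refine Finset.prod_congr rfl fun i _ => ?_
    have h1 : ((i : ℕ) : ZMod (m + 1)) = (show ZMod (m + 1) from i.castSucc) := by
      apply ZMod.val_injective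
      rw [ZMod.val_natCast_of_lt (by omega)]
      rfl
    have h2 : (i.castSucc : Fin (m + 1)) + 1 = i.succ := by
      simp
    rw [h1]
    congr 1
    exact congrArg s h2.symm
  · have h1 : ((m : ℕ) : ZMod (m + 1)) = (show ZMod (m + 1) from Fin.last m) := by
      apply ZMod.val_injective
      rw [ZMod.val_natCast_of_lt (by omega)]
      rfl
    rw [h1]
    congr 1
    exact congrArg s (Fin.last_add_one m).symm

/-- Telescoping of gauge transformations in a cyclic product. -/
theorem trace_orderedProd_gauge {R : Type*} [CommRing R] (n : ℕ) [NeZero n]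
    (Y g h : ZMod n → Matrix (Fin 2) (Fin 2) R) (hg : ∀ k, g k * h k = 1) :
    (orderedProd (fun k => g ((k + 1 : ℕ) : ZMod n) * Y k) n).trace =
      (orderedProd (fun k => Y k * g k) n).trace := by
  -- The two products differ by half a step. At `m = n` the index returns to 0, so they are
  -- conjugate by `g 0`.
  have key : ∀ m : ℕ, orderedProd (fun k => g ((k + 1 : ℕ) : ZMod n) * Y k) m * g 0 =
      g (m : ZMod n) * orderedProd (fun k => Y k * g k) m := by
    intro m
    induction m with
    | zero => simp
    | succ m ih =>
      rw [orderedProd_succ, orderedProd_succ, mul_assoc, ih]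
      simp only [mul_assoc]
  have h1 := key n
  rw [ZMod.natCast_self] at h1
  have h2 : h 0 * g 0 = 1 := mul_eq_one_comm.1 (hg 0)
  calc _ = (orderedProd (fun k => g ((k + 1 : ℕ) : ZMod n) * Y k) n * g 0 * h 0).trace := by
        rw [mul_assoc, hg, mul_one]
    _ = _ := by
        rw [h1, mul_assoc, Matrix.trace_mul_comm, mul_assoc, h2, mul_one]

theorem orderedProd_smul {R : Type*} [CommRing R] (c : ℕ → R)
    (X : ℕ → Matrix (Fin 2) (Fin 2) R) (n : ℕ) :
    orderedProd (fun k => c k • X k) n = (∏ k ∈ Finset.range n, c k) • orderedProd X n := by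
  induction n with
  | zero => simp
  | succ n ih => rw [orderedProd_succ, orderedProd_succ, ih, Finset.prod_range_succ,
      smul_mul_smul_comm, mul_comm (c n)]

theorem prod_range_eq_prod_zmod {R : Type*} [CommMonoid R] (n : ℕ) [NeZero n] (c : ZMod n → R) :
    ∏ k ∈ Finset.range n, c k = ∏ k, c k := by
  refine Finset.prod_bij (fun k _ => (k : ZMod n)) (by simp) ?_ ?_ (fun _ _ => rfl)
  · intro a ha b hb h
    rw [Finset.mem_range] at ha hb
    have := congrArg ZMod.val h
    rwa [ZMod.val_natCast_of_lt ha, ZMod.val_natCast_of_lt hb] at this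
  · intro b _
    exact ⟨b.val, by simpa using ZMod.val_lt b, ZMod.natCast_zmod_val b⟩

/-! ### Closed loops of a double dimer configuration -/

section Loops

variable {V : Type*} [Fintype V] {G : SimpleGraph V}

theorem DoubleDimer.adj (D : DoubleDimer G) {u v : V} (h : D.mult s(u, v) ≠ 0) : G.Adj u v := by
  by_contra hn
  exact h (D.mult_eq_zero _ hn)

/-- At each vertex there is either one doubled edge or there are two simple edges. -/
theorem DoubleDimer.cases (D : DoubleDimer G) (v : V) :
    (∃ w, D.mult s(v, w) = 2 ∧ ∀ w', w' ≠ w → D.mult s(v, w') = 0) ∨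
    ∃ w₁ w₂, w₁ ≠ w₂ ∧ D.mult s(v, w₁) = 1 ∧ D.mult s(v, w₂) = 1 ∧
      ∀ w', w' ≠ w₁ → w' ≠ w₂ → D.mult s(v, w') = 0 := by
  classical
  have hsum := D.degree_eq_two v
  have h012 : ∀ w, D.mult s(v, w) = 0 ∨ D.mult s(v, w) = 1 ∨ D.mult s(v, w) = 2 := by
    intro w
    generalize D.mult s(v, w) = a
    revert a; decide
  have hz : ∀ {s : Finset V}, ∑ u ∈ s, (D.mult s(v, u) : ℕ) = 0 → ∀ u ∈ s, D.mult s(v, u) = 0 := by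
    intro s hs u hu
    exact Fin.ext (Finset.sum_eq_zero_iff.1 hs u hu)
  obtain ⟨w, -, hw⟩ : ∃ w ∈ (Finset.univ : Finset V), (D.mult s(v, w) : ℕ) ≠ 0 := by
    apply Finset.exists_ne_zero_of_sum_ne_zero
    rw [hsum]; decide
  rw [← Finset.add_sum_erase _ _ (Finset.mem_univ w)] at hsum
  rcases h012 w with h | h | h
  · rw [h] at hw; exact absurd rfl hw
  · right
    rw [h] at hsum
    have hsum' : ∑ u ∈ Finset.univ.erase w, (D.mult s(v, u) : ℕ) = 1 := by
      change 1 + _ = 2 at hsum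
      omega
    obtain ⟨w', hw', hne⟩ : ∃ w' ∈ Finset.univ.erase w, (D.mult s(v, w') : ℕ) ≠ 0 := by
      apply Finset.exists_ne_zero_of_sum_ne_zero
      rw [hsum']; decide
    rw [← Finset.add_sum_erase _ _ hw'] at hsum'
    have h1 : D.mult s(v, w') = 1 := Fin.ext (by change _ = 1; omega)
    rw [h1] at hsum'
    have h0 : ∑ u ∈ (Finset.univ.erase w).erase w', (D.mult s(v, u) : ℕ) = 0 := by
      change 1 + _ = 1 at hsum'
      omega
    refine ⟨w, w', (Finset.ne_of_mem_erase hw').symm, h, h1, fun w'' h2 h3 => ?_⟩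
    exact hz h0 w'' (by simp [h2, h3])
  · left
    rw [h] at hsum
    have h0 : ∑ u ∈ Finset.univ.erase w, (D.mult s(v, u) : ℕ) = 0 := by
      change 2 + _ = 2 at hsum
      omega
    exact ⟨w, h, fun w' h2 => hz h0 w' (by simp [h2])⟩

/-- A cyclic parametrization of a closed loop of `D`. -/
structure LoopParam (D : DoubleDimer G) where
  n : ℕ
  three_le : 3 ≤ n
  vert : ZMod n → V
  inj : Function.Injective vert
  mult_one : ∀ k, D.mult s(vert k, vert (k + 1)) = 1

instance {D : DoubleDimer G} (P : LoopParam D) : NeZero P.n := ⟨by have := P.three_le; omega⟩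

namespace LoopParam

variable {D : DoubleDimer G} (P : LoopParam D)

theorem mult_one' (k : ZMod P.n) : D.mult s(P.vert k, P.vert (k - 1)) = 1 := by
  have := P.mult_one (k - 1)
  rwa [sub_add_cancel, Sym2.eq_swap] at this

theorem adj (k : ZMod P.n) : G.Adj (P.vert k) (P.vert (k + 1)) :=
  D.adj (by rw [P.mult_one]; decide)

theorem two_ne_zero : (2 : ZMod P.n) ≠ 0 := by
  intro h
  have h2 : ((2 : ℕ) : ZMod P.n) = 0 := by exact_mod_cast h
  rw [ZMod.natCast_eq_zero_iff] at h2
  have := Nat.le_of_dvd (by norm_num) h2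
  have := P.three_le
  omega

theorem vert_succ_ne (k : ZMod P.n) : P.vert (k + 1) ≠ P.vert (k - 1) := by
  intro h
  have := P.inj h
  apply P.two_ne_zero
  linear_combination this

/-- The edges of `D` at a vertex of a loop are the two edges of the loop. -/
theorem mult_vert (k : ZMod P.n) (w : V) (hw : D.mult s(P.vert k, w) ≠ 0) :
    w = P.vert (k + 1) ∨ w = P.vert (k - 1) := by
  have h1 := P.mult_one k
  have h2 := P.mult_one' k
  have h3 := P.vert_succ_ne k
  rcases D.cases (P.vert k) with ⟨w₀, h, h'⟩ | ⟨w₁, w₂, -, -, -, h'⟩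
  · exfalso
    by_cases e : P.vert (k + 1) = w₀
    · rw [e, h] at h1; exact absurd h1 (by decide)
    · rw [h' _ e] at h1; exact absurd h1 (by decide)
  · have key : ∀ w, D.mult s(P.vert k, w) ≠ 0 → w = w₁ ∨ w = w₂ := by
      intro w hw
      by_contra hc
      push Not at hc
      exact hw (h' w hc.1 hc.2)
    have e1 := key _ (by rw [h1]; decide : D.mult s(P.vert k, P.vert (k + 1)) ≠ 0)
    have e2 := key _ (by rw [h2]; decide : D.mult s(P.vert k, P.vert (k - 1)) ≠ 0)
    have e3 := key w hw
    grind

/-- Following `P` from the common vertex, each next vertex is joined to the previous one by an edge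
of `D`, and `Q` contains both such neighbours of each of its vertices. -/
theorem range_subset (Q : LoopParam D) {j : ZMod P.n} {m : ZMod Q.n} (h : P.vert j = Q.vert m) :
    Set.range P.vert ⊆ Set.range Q.vert := by
  have key : ∀ i : ℕ, P.vert (j + i) ∈ Set.range Q.vert := by
    intro i
    induction i with
    | zero => exact ⟨m, by simp [h]⟩
    | succ i ih =>
      obtain ⟨m', hm'⟩ := ih
      have h1 := P.mult_one (j + i)
      rw [← hm'] at h1
      rcases Q.mult_vert m' _ (by rw [h1]; decide) with h2 | h2
      · exact ⟨_, by rw [← h2]; push_cast; ring_nf⟩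
      · exact ⟨_, by rw [← h2]; push_cast; ring_nf⟩
  rintro _ ⟨k, rfl⟩
  have := key (k - j).val
  rwa [ZMod.natCast_zmod_val, add_sub_cancel] at this

/-- The edges of a loop. -/
def edges : Set (Sym2 V) := Set.range fun k => s(P.vert k, P.vert (k + 1))

/-- The right side depends on the loop only through its vertex set, so loops of `D` with the same
vertices have the same edges. -/
theorem mem_edges_iff (a b : V) :
    s(a, b) ∈ P.edges ↔ a ∈ Set.range P.vert ∧ D.mult s(a, b) = 1 := by
  constructor
  · rintro ⟨k, hk⟩
    have := P.mult_one k
    simp only at hk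
    refine ⟨?_, hk ▸ this⟩
    rcases Sym2.eq_iff.1 hk with h | h
    · exact ⟨_, h.1⟩
    · exact ⟨_, h.2⟩
  · rintro ⟨⟨k, rfl⟩, h⟩
    rcases P.mult_vert k b (by rw [h]; decide) with rfl | rfl
    · exact ⟨k, rfl⟩
    · refine ⟨k - 1, ?_⟩
      simp only [sub_add_cancel]
      exact Sym2.eq_swap

theorem edges_eq (Q : LoopParam D) {j : ZMod P.n} {m : ZMod Q.n} (h : P.vert j = Q.vert m) :
    P.edges = Q.edges := by
  have h1 : Set.range P.vert = Set.range Q.vert :=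
    Set.Subset.antisymm (P.range_subset Q h) (Q.range_subset P h.symm)
  ext e
  induction e with | _ a b
  rw [mem_edges_iff, mem_edges_iff, h1]

/-- The parametrization of a loop by a cycle. -/
def ofWalk {v : V} (p : G.Walk v v) (hp : p.IsCycle) (h : ∀ e ∈ p.edges, D.mult e = 1) :
    LoopParam D where
  n := p.length
  three_le := hp.three_le_length
  vert k := p.getVert k.val
  inj := by
    have : NeZero p.length := ⟨by have := hp.three_le_length; omega⟩
    intro a b hab
    apply ZMod.val_injective
    refine hp.getVert_injOn' ?_ ?_ hab
    · have := ZMod.val_lt a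
      simp only [Set.mem_ofPred_eq]; omega
    · have := ZMod.val_lt b
      simp only [Set.mem_ofPred_eq]; omega
  mult_one := by
    have h3 := hp.three_le_length
    have : NeZero p.length := ⟨by omega⟩
    intro k
    apply h
    rw [SimpleGraph.Walk.mk_mem_edges_iff_exists]
    refine ⟨k.val, ZMod.val_lt k, ?_⟩
    refine congrArg (fun w => s(p.getVert k.val, w)) ?_
    rw [ZMod.val_add, ZMod.val_one'' (by omega)]
    have hk := ZMod.val_lt k
    rcases Nat.lt_or_ge (k.val + 1) p.length with h1 | h1
    · rw [Nat.mod_eq_of_lt h1]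
    · have h2 : k.val + 1 = p.length := by omega
      rw [h2, Nat.mod_self, p.getVert_length, p.getVert_zero]

theorem ofWalk_vert_natCast {v : V} (p : G.Walk v v) (hp : p.IsCycle)
    (h : ∀ e ∈ p.edges, D.mult e = 1) (k : ℕ) (hk : k ≤ p.length) :
    (ofWalk p hp h).vert (k : ZMod p.length) = p.getVert k := by
  have h3 := hp.three_le_length
  have : NeZero p.length := ⟨by omega⟩
  change p.getVert (k : ZMod p.length).val = _
  rw [ZMod.val_natCast]
  rcases hk.lt_or_eq with h1 | h1
  · rw [Nat.mod_eq_of_lt h1]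
  · rw [h1, Nat.mod_self, p.getVert_length, p.getVert_zero]

theorem ofWalk_edges {v : V} (p : G.Walk v v) (hp : p.IsCycle)
    (h : ∀ e ∈ p.edges, D.mult e = 1) : (ofWalk p hp h).edges = {e | e ∈ p.edges} := by
  have h3 := hp.three_le_length
  have : NeZero p.length := ⟨by omega⟩
  ext e
  induction e with | _ a b
  rw [Set.mem_ofPred_eq, SimpleGraph.Walk.mk_mem_edges_iff_exists]
  have hv := ofWalk_vert_natCast p hp h
  constructor
  · rintro ⟨k, hk⟩
    have hk' : (k : ZMod p.length).val < p.length := ZMod.val_lt k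
    refine ⟨_, hk', ?_⟩
    have e : ((k.val + 1 : ℕ) : ZMod p.length) = (show ZMod p.length from k) + 1 := by
      push_cast
      congr 1
      exact ZMod.natCast_zmod_val (n := p.length) k
    have h2 := hv _ hk'
    rw [e] at h2
    rw [← hk, ← h2]
    rfl
  · rintro ⟨k, hk, hk'⟩
    refine ⟨(k : ZMod p.length), ?_⟩
    rw [← hk', ← hv _ hk.le, ← hv _ hk]
    push_cast
    rfl

end LoopParam

/-- A cycle of simple edges through a vertex that lies on a simple edge. -/
theorem DoubleDimer.exists_cycle (D : DoubleDimer G) {v w : V} (h : D.mult s(v, w) = 1) :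
    ∃ p : G.Walk v v, p.IsCycle ∧ ∀ e ∈ p.edges, D.mult e = 1 := by
  classical
  -- In the graph of simple edges a vertex has degree 0 or 2, so the component of `v` is a cycle.
  let H : SimpleGraph V :=
    { Adj := fun a b => D.mult s(a, b) = 1
      symm := ⟨fun a b hab => by rwa [Sym2.eq_swap]⟩
      loopless := ⟨fun a ha => G.loopless.irrefl a (D.adj (by rw [ha]; decide))⟩ }
  have hH : H ≤ G := fun a b hab => D.adj (by rw [show D.mult s(a, b) = 1 from hab]; decide)
  have hcyc : H.IsCycles := by
    rintro a ⟨b, hb⟩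
    have hb' : D.mult s(a, b) = 1 := hb
    rcases D.cases a with ⟨w₀, h, h'⟩ | ⟨w₁, w₂, hne, h1, h2, h'⟩
    · exfalso
      by_cases e : b = w₀
      · rw [e, h] at hb'; exact absurd hb' (by decide)
      · rw [h' _ e] at hb'; exact absurd hb' (by decide)
    · have : H.neighborSet a = {w₁, w₂} := by
        ext c
        change D.mult s(a, c) = 1 ↔ _
        rw [Set.mem_insert_iff, Set.mem_singleton_iff]
        constructor
        · intro hc
          by_contra hn
          push Not at hn
          rw [h' c hn.1 hn.2] at hc
          exact absurd hc (by decide)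
        · rintro (rfl | rfl) <;> assumption
      rw [this, Set.ncard_pair hne]
  obtain ⟨p, hp, -⟩ := hcyc.exists_cycle_toSubgraph_verts_eq_connectedComponentSupp
    (c := H.connectedComponentMk v) (v := v) rfl ⟨w, h⟩
  refine ⟨p.mapLe hH, hp.mapLe hH, ?_⟩
  intro e he
  rw [SimpleGraph.Walk.edges_mapLe_eq_edges] at he
  have := p.edges_subset_edgeSet he
  induction e with | _ a b
  exact this

/-- The parametrization of a loop that is used in its trace. -/
def loopParam (D : DoubleDimer G) (ℓ : {ℓ : Finset (Sym2 V) // D.IsLoop ℓ}) : LoopParam D :=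
  LoopParam.ofWalk ℓ.2.choose_spec.choose ℓ.2.choose_spec.choose_spec.1
    ℓ.2.choose_spec.choose_spec.2.1

theorem loopParam_edges (D : DoubleDimer G) (ℓ : {ℓ : Finset (Sym2 V) // D.IsLoop ℓ}) :
    (loopParam D ℓ).edges = (ℓ.1 : Set (Sym2 V)) := by
  classical
  unfold loopParam
  rw [LoopParam.ofWalk_edges]
  have := ℓ.2.choose_spec.choose_spec.2.2
  ext e
  rw [Set.mem_ofPred_eq, Finset.mem_coe]
  conv_rhs => rw [← this]
  rw [List.mem_toFinset]

/-- The loops are disjoint. -/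
theorem loopParam_inj (D : DoubleDimer G) (ℓ ℓ' : {ℓ : Finset (Sym2 V) // D.IsLoop ℓ})
    (k : ZMod (loopParam D ℓ).n) (k' : ZMod (loopParam D ℓ').n)
    (h : (loopParam D ℓ).vert k = (loopParam D ℓ').vert k') :
    (⟨ℓ, k⟩ : Σ ℓ, ZMod (loopParam D ℓ).n) = ⟨ℓ', k'⟩ := by
  have h1 := (loopParam D ℓ).edges_eq _ h
  rw [loopParam_edges, loopParam_edges, Finset.coe_inj] at h1
  have h2 := Subtype.ext h1
  subst h2
  rw [(loopParam D ℓ).inj h]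

/-- Every simple edge lies on a loop. -/
theorem exists_loopParam (D : DoubleDimer G) {v w : V} (h : D.mult s(v, w) = 1) :
    ∃ (ℓ : {ℓ : Finset (Sym2 V) // D.IsLoop ℓ}) (k : ZMod (loopParam D ℓ).n),
      (loopParam D ℓ).vert k = v := by
  classical
  obtain ⟨p, hp, hp'⟩ := D.exists_cycle h
  have h3 := hp.three_le_length
  refine ⟨⟨p.edges.toFinset, v, p, hp, hp', by congr⟩, ?_⟩
  have h1 : s(p.getVert 0, p.getVert 1) ∈ (loopParam D
      ⟨p.edges.toFinset, v, p, hp, hp', by congr⟩).edges := by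
    rw [loopParam_edges, Finset.mem_coe, List.mem_toFinset,
      SimpleGraph.Walk.mk_mem_edges_iff_exists]
    exact ⟨0, by omega, rfl⟩
  rw [p.getVert_zero] at h1
  exact (((loopParam D _).mem_edges_iff _ _).1 h1).1

/-- The trace of a loop as the trace of an ordered product. -/
theorem loopTrace_eq (Γ : SL2Connection G) (N : V → V → Matrix (Fin 2) (Fin 2) ℂ)
    (hN : ∀ d, (Γ.mat d : Matrix (Fin 2) (Fin 2) ℂ) = N d.fst d.snd) (D : DoubleDimer G)
    (ℓ : {ℓ : Finset (Sym2 V) // D.IsLoop ℓ}) :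
    Γ.loopTrace ℓ.2 = (orderedProd (fun k : ℕ => N ((loopParam D ℓ).vert k)
      ((loopParam D ℓ).vert ((k : ZMod (loopParam D ℓ).n) + 1))) (loopParam D ℓ).n).trace := by
  classical
  unfold SL2Connection.loopTrace SL2Connection.monodromy
  congr 1
  -- `loopParam` is built from the very cycle that `loopTrace` chooses, so independence of the base
  -- point and the direction is not needed.
  set p := ℓ.2.choose_spec.choose with hp
  have h1 : ∀ l : List (Matrix.SpecialLinearGroup (Fin 2) ℂ),
      ((l.prod : Matrix.SpecialLinearGroup (Fin 2) ℂ) : Matrix (Fin 2) (Fin 2) ℂ) =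
        (l.map fun A : Matrix.SpecialLinearGroup (Fin 2) ℂ => A.1).prod := by
    intro l
    induction l with
    | nil => simp
    | cons a l ih => simp [ih]
  rw [h1, List.map_reverse, List.map_map, orderedProd]
  congr 2
  have hlen : (loopParam D ℓ).n = p.length := rfl
  apply List.ext_getElem
  · simp [hlen]
  · intro i hi hi'
    simp only [List.getElem_map, List.getElem_range, Function.comp, hN]
    have hi2 : i < p.length := by simpa using hi
    have hv := LoopParam.ofWalk_vert_natCast p ℓ.2.choose_spec.choose_spec.1
      ℓ.2.choose_spec.choose_spec.2.1
    rw [SimpleGraph.Walk.darts_getElem_eq_getVert]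
    have e1 := hv i hi2.le
    have e2 := hv (i + 1) hi2
    push_cast at e2
    exact (congrArg₂ N e1 e2).symm

end Loops

/-! ### The squish map -/

/-- A proper colouring of the edges of a graph with three colours. -/
structure EdgeColoring {V : Type*} (G : SimpleGraph V) where
  ty : V → V → ZMod 3
  symm : ∀ u v, ty u v = ty v u
  inj : ∀ u v w, G.Adj u v → G.Adj u w → ty u v = ty u w → v = w

/-- The colours other than `t`. -/
def leaf (t : ZMod 3) (s : Fin 2) : ZMod 3 := if s = 0 then t + 1 else t + 2

theorem leaf_injective (t : ZMod 3) : Function.Injective (leaf t) := by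
  revert t; unfold Function.Injective leaf; decide

theorem leaf_ne (t : ZMod 3) (s : Fin 2) : leaf t s ≠ t := by
  revert t s; unfold leaf; decide

theorem leaf_ne_leaf (t : ZMod 3) (s : Fin 2) : leaf t s ≠ leaf t (1 - s) := by
  revert t s; unfold leaf; decide

theorem exists_leaf_pair (t x y : ZMod 3) (h : x ≠ t) (h' : y ≠ t) (h'' : x ≠ y) :
    ∃ s, x = leaf t s ∧ y = leaf t (1 - s) := by
  revert t x y; unfold leaf; decide

theorem Fin.two_sub_sub (s : Fin 2) : 1 - (1 - s) = s := by revert s; decide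

theorem existsUnique_third (x y : ZMod 3) (h : x ≠ y) :
    ∃ z, z ≠ x ∧ z ≠ y ∧ ∀ w, w ≠ x → w ≠ y → w = z := by
  revert x y; decide

/-- Every vertex is replaced by a tripod whose leaves are indexed by the colour of the opposite
edge, and every edge of colour `t` by two strands, which join the leaves of colours other
than `t`. -/
def squish {V : Type*} (G : SimpleGraph V) (c : EdgeColoring G) :
    SimpleGraph (V × Option (ZMod 3)) where
  Adj
    | (u, none), (v, some _) => u = v
    | (u, some _), (v, none) => u = v
    | (u, some x), (v, some y) => G.Adj u v ∧ x ≠ c.ty u v ∧ y ≠ c.ty u v ∧ x ≠ y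
    | (_, none), (_, none) => False
  symm := ⟨by
    rintro ⟨u, _ | x⟩ ⟨v, _ | y⟩ h
    · exact h
    · exact Eq.symm h
    · exact Eq.symm h
    · exact ⟨h.1.symm, c.symm u v ▸ h.2.2.1, c.symm u v ▸ h.2.1, h.2.2.2.symm⟩⟩
  loopless := ⟨by
    rintro ⟨u, _ | x⟩ h
    · exact h
    · exact h.2.2.2 rfl⟩

/-- The bipartition of the squished graph. -/
def squishSide {V : Type*} (side : V → Bool) : V × Option (ZMod 3) → Bool
  | (u, none) => !side u
  | (u, some _) => side u

section

variable {V : Type*} {G : SimpleGraph V} {c : EdgeColoring G}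

theorem squish_adj_leaf {u v : V} (h : G.Adj u v) (s : Fin 2) :
    (squish G c).Adj (u, some (leaf (c.ty u v) s)) (v, some (leaf (c.ty u v) (1 - s))) :=
  ⟨h, leaf_ne _ _, leaf_ne _ _, leaf_ne_leaf _ _⟩

theorem squish_side (side : V → Bool) (hs : ∀ u v, G.Adj u v → side u ≠ side v)
    (a b : V × Option (ZMod 3)) (h : (squish G c).Adj a b) :
    squishSide side a ≠ squishSide side b := by
  obtain ⟨u, _ | x⟩ := a <;> obtain ⟨v, _ | y⟩ := b
  · exact h.elim
  · obtain rfl : u = v := h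
    simp [squishSide]
  · obtain rfl : u = v := h
    simp [squishSide]
  · exact hs _ _ h.1

/-- The strand number `s` of the edge from `u` to `v` belongs to the matching `f`. Strand `0` is
the left one. -/
def HasStrand (f : Matching (squish G c)) (u v : V) (s : Fin 2) : Prop :=
  f.1 (u, some (leaf (c.ty u v) s)) = (v, some (leaf (c.ty u v) (1 - s)))

theorem HasStrand.swap {f : Matching (squish G c)} {u v : V} {s : Fin 2} (h : HasStrand f u v s) :
    HasStrand f v u (1 - s) := by
  unfold HasStrand at h ⊢
  rw [c.symm v u, Fin.two_sub_sub, ← h, f.2.2]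

theorem HasStrand.adj {f : Matching (squish G c)} {u v : V} {s : Fin 2} (h : HasStrand f u v s) :
    G.Adj u v := by
  have := f.2.1 (u, some (leaf (c.ty u v) s))
  rw [show f.1 _ = _ from h] at this
  exact this.1

theorem exists_hasStrand {f : Matching (squish G c)} {u v : V} {x y : ZMod 3}
    (h : f.1 (u, some x) = (v, some y)) :
    ∃ s, x = leaf (c.ty u v) s ∧ y = leaf (c.ty u v) (1 - s) ∧ HasStrand f u v s := by
  have := f.2.1 (u, some x)
  rw [h] at this
  obtain ⟨s, rfl, rfl⟩ := exists_leaf_pair _ x y this.2.1 this.2.2.1 this.2.2.2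
  exact ⟨s, rfl, rfl, h⟩

theorem matching_none (f : Matching (squish G c)) (u : V) : ∃ x, f.1 (u, none) = (u, some x) := by
  have := f.2.1 (u, none)
  rcases h : f.1 (u, none) with ⟨v, _ | x⟩
  · rw [h] at this; exact this.elim
  · rw [h] at this
    obtain rfl : u = v := this
    exact ⟨x, rfl⟩

theorem matching_some (f : Matching (squish G c)) (u : V) (x : ZMod 3)
    (hx : f.1 (u, some x) ≠ (u, none)) : ∃ v y, f.1 (u, some x) = (v, some y) := by
  have := f.2.1 (u, some x)
  rcases h : f.1 (u, some x) with ⟨v, _ | y⟩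
  · rw [h] at this
    obtain rfl : u = v := this
    exact absurd h hx
  · exact ⟨v, y, rfl⟩

open Classical in
/-- The strands at `u` correspond to the leaves of `u` that are not matched with the centre. -/
theorem image_hasStrand [Fintype V] (f : Matching (squish G c)) (u : V) :
    ((Finset.univ : Finset (V × Fin 2)).filter fun p => HasStrand f u p.1 p.2).image
      (fun p => leaf (c.ty u p.1) p.2) =
      Finset.univ.filter fun x => f.1 (u, some x) ≠ (u, none) := by
  ext x
  simp only [Finset.mem_image, Finset.mem_filter, Finset.mem_univ, true_and]
  constructor
  · rintro ⟨⟨v, s⟩, h, rfl⟩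
    rw [show f.1 _ = _ from h]
    simp
  · intro h
    obtain ⟨v, y, hvy⟩ := matching_some f u x h
    obtain ⟨s, rfl, -, hs⟩ := exists_hasStrand hvy
    exact ⟨(v, s), hs, rfl⟩

theorem injOn_hasStrand (f : Matching (squish G c)) (u : V) :
    Set.InjOn (fun p : V × Fin 2 => leaf (c.ty u p.1) p.2) {p | HasStrand f u p.1 p.2} := by
  rintro ⟨v, s⟩ h ⟨v', s'⟩ h' heq
  have h1 : f.1 _ = _ := h
  have h2 : f.1 _ = _ := h'
  simp only at heq h1 h2
  rw [heq] at h1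
  rw [h1] at h2
  have hv : v = v' := congrArg Prod.fst h2
  subst hv
  rw [leaf_injective _ heq]

open Classical in
/-- The number of strands of an edge in a matching. -/
def strandCount (f : Matching (squish G c)) (u v : V) : ℕ :=
  (Finset.univ.filter fun s => HasStrand f u v s).card

theorem strandCount_comm (f : Matching (squish G c)) (u v : V) :
    strandCount f u v = strandCount f v u := by
  classical
  unfold strandCount
  refine Finset.card_bij' (fun s _ => 1 - s) (fun s _ => 1 - s) ?_ ?_ ?_ ?_
  · intro s hs
    rw [Finset.mem_filter] at hs ⊢
    exact ⟨Finset.mem_univ _, hs.2.swap⟩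
  · intro s hs
    rw [Finset.mem_filter] at hs ⊢
    exact ⟨Finset.mem_univ _, hs.2.swap⟩
  · exact fun s _ => Fin.two_sub_sub s
  · exact fun s _ => Fin.two_sub_sub s

theorem strandCount_lt (f : Matching (squish G c)) (u v : V) : strandCount f u v < 3 :=
  Nat.lt_succ_of_le ((Finset.card_le_univ _).trans (by simp))

/-- The strands at `u` correspond to the leaves not matched with the centre, and the centre takes
exactly one of the three leaves. -/
theorem strandCount_sum [Fintype V] (f : Matching (squish G c)) (u : V) : ∑ v, strandCount f u v = 2 := by
  classical
  have h1 : ∑ v, strandCount f u v =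
      ((Finset.univ : Finset (V × Fin 2)).filter fun p => HasStrand f u p.1 p.2).card := by
    rw [Finset.card_filter, Fintype.sum_prod_type]
    refine Finset.sum_congr rfl fun v _ => ?_
    rw [strandCount, Finset.card_filter]
  rw [h1, ← Finset.card_image_of_injOn (f := fun p : V × Fin 2 => leaf (c.ty u p.1) p.2)
    (by simpa using injOn_hasStrand f u), image_hasStrand]
  obtain ⟨x, hx⟩ := matching_none f u
  have : (Finset.univ.filter fun x => f.1 (u, some x) ≠ (u, none)) = Finset.univ.erase x := by
    ext y
    simp only [Finset.mem_filter, Finset.mem_univ, true_and, Finset.mem_erase, and_true, ne_eq,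
      not_iff_not]
    constructor
    · intro h
      rw [← h, f.2.2] at hx
      simpa using hx
    · rintro rfl
      rw [← hx, f.2.2]
  rw [this, Finset.card_erase_of_mem (Finset.mem_univ _)]
  rfl

variable [Fintype V]

/-- The double dimer configuration obtained by squishing a matching. -/
def squishMap (f : Matching (squish G c)) : DoubleDimer G where
  mult := Sym2.lift ⟨fun u v => ⟨strandCount f u v, strandCount_lt f u v⟩,
    fun u v => Fin.ext (strandCount_comm f u v)⟩
  mult_eq_zero := by
    classical
    intro e he
    induction e with | _ u v
    apply Fin.ext
    change (Finset.univ.filter fun s => HasStrand f u v s).card = 0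
    rw [Finset.card_eq_zero, Finset.filter_eq_empty_iff]
    intro s _ hs
    exact he hs.adj
  degree_eq_two v := strandCount_sum f v

theorem squishMap_eq_iff (f : Matching (squish G c)) (D : DoubleDimer G) :
    squishMap f = D ↔ ∀ u v, strandCount f u v = (D.mult s(u, v) : ℕ) := by
  constructor
  · rintro rfl u v
    rfl
  · intro h
    have : (squishMap f).mult = D.mult := by
      funext e
      induction e with | _ u v
      exact Fin.ext (h u v)
    cases D
    simp only [squishMap] at this ⊢
    subst this
    rfl

/-! ### Strands along oriented loops -/

/-- Orientations of all loops of a double dimer configuration: `src i` and `src (nxt i)` are the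
ends of the edge number `i`, and `nxt i` is the number of the next edge. -/
structure Orientation (D : DoubleDimer G) (I : Type*) where
  src : I → V
  nxt : Equiv.Perm I
  inj : Function.Injective src
  mult_one : ∀ i, D.mult s(src i, src (nxt i)) = 1
  ne : ∀ i, src (nxt i) ≠ src (nxt.symm i)
  mult_src : ∀ i w, D.mult s(src i, w) ≠ 0 → w = src (nxt i) ∨ w = src (nxt.symm i)
  cover : ∀ v w, D.mult s(v, w) = 1 → ∃ i, src i = v

namespace Orientation

variable {D : DoubleDimer G} {I : Type*} (O : Orientation D I)

theorem adj (i : I) : G.Adj (O.src i) (O.src (O.nxt i)) :=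
  D.adj (by rw [O.mult_one]; decide)

theorem ne' (i : I) : O.src (O.nxt (O.nxt i)) ≠ O.src i := by
  have := O.ne (O.nxt i)
  rwa [Equiv.symm_apply_apply] at this

theorem exists_edge {u v : V} (h : D.mult s(u, v) = 1) :
    ∃ i, (O.src i = u ∧ O.src (O.nxt i) = v) ∨ (O.src i = v ∧ O.src (O.nxt i) = u) := by
  obtain ⟨i, rfl⟩ := O.cover u v h
  rcases O.mult_src i v (by rw [h]; decide) with rfl | rfl
  · exact ⟨i, Or.inl ⟨rfl, rfl⟩⟩
  · exact ⟨O.nxt.symm i, Or.inr ⟨rfl, by simp⟩⟩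

/-- The colour of an edge. -/
def ty (c : EdgeColoring G) (i : I) : ZMod 3 := c.ty (O.src i) (O.src (O.nxt i))

/-- The strands chosen on two consecutive edges use different leaves. -/
def Compatible (c : EdgeColoring G) (σ : I → Fin 2) : Prop :=
  ∀ i, leaf (O.ty c i) (1 - σ i) ≠ leaf (O.ty c (O.nxt i)) (σ (O.nxt i))

open Classical in
/-- The strands of a matching on the loops of `D`. -/
def strands (f : Matching (squish G c)) (i : I) : Fin 2 :=
  if HasStrand f (O.src i) (O.src (O.nxt i)) 0 then 0 else 1

variable {O}

/-- An edge of multiplicity one carries exactly one strand, so the value 1 that `strands` takes in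
the absence of strand 0 is the right one. -/
theorem hasStrand_iff {f : Matching (squish G c)} (hf : squishMap f = D) (i : I) (s : Fin 2) :
    HasStrand f (O.src i) (O.src (O.nxt i)) s ↔ s = O.strands f i := by
  classical
  have h := (squishMap_eq_iff f D).1 hf (O.src i) (O.src (O.nxt i))
  rw [O.mult_one] at h
  obtain ⟨s₀, hs₀⟩ := Finset.card_eq_one.1 h
  have key : ∀ s, HasStrand f (O.src i) (O.src (O.nxt i)) s ↔ s = s₀ := by
    intro s
    have := Finset.ext_iff.1 hs₀ s
    simpa using this
  rw [key]
  have : O.strands f i = s₀ := by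
    unfold strands
    rw [key]
    split_ifs with h0
    · exact h0
    · clear hs₀ key; revert h0; revert s₀; decide
  rw [this]

theorem hasStrand_of_two {f : Matching (squish G c)} (hf : squishMap f = D) {u v : V}
    (h : D.mult s(u, v) = 2) (s : Fin 2) : HasStrand f u v s := by
  classical
  have h' := (squishMap_eq_iff f D).1 hf u v
  rw [h] at h'
  have : (Finset.univ.filter fun s => HasStrand f u v s) = Finset.univ :=
    (Finset.card_eq_iff_eq_univ _).1 h'
  exact (Finset.mem_filter.1 (this ▸ Finset.mem_univ s)).2

theorem not_hasStrand_of_zero {f : Matching (squish G c)} (hf : squishMap f = D) {u v : V}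
    (h : D.mult s(u, v) = 0) (s : Fin 2) : ¬ HasStrand f u v s := by
  classical
  have h' := (squishMap_eq_iff f D).1 hf u v
  rw [h] at h'
  have h2 := Finset.card_eq_zero.1 h'
  exact fun hs => (Finset.filter_eq_empty_iff.1 h2) (Finset.mem_univ s) hs

/-- A shared leaf would be matched both backwards and forwards along the loop, but the vertices
before and after a turn are different. -/
theorem strands_compatible {f : Matching (squish G c)} (hf : squishMap f = D) :
    O.Compatible c (O.strands f) := by
  intro i h
  have h1 : f.1 _ = _ := ((hasStrand_iff (O := O) hf i _).2 rfl).swap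
  have h2 : f.1 _ = _ := (hasStrand_iff (O := O) hf (O.nxt i) _).2 rfl
  rw [c.symm] at h1
  unfold ty at h
  rw [h, h2] at h1
  exact O.ne' i (congrArg Prod.fst h1)

theorem mult_trichotomy (D : DoubleDimer G) (u v : V) :
    D.mult s(u, v) = 0 ∨ D.mult s(u, v) = 1 ∨ D.mult s(u, v) = 2 := by
  generalize D.mult s(u, v) = a
  revert a; decide

/-- Doubled edges carry both strands and unused edges none, so the strands on the loops determine
the partners of all leaves. Each centre is left with the one remaining leaf. -/
theorem strands_injective {f f' : Matching (squish G c)} (hf : squishMap f = D)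
    (hf' : squishMap f' = D) (h : O.strands f = O.strands f') : f = f' := by
  have key : ∀ {f f' : Matching (squish G c)}, squishMap f = D → squishMap f' = D →
      O.strands f = O.strands f' → ∀ u v s, HasStrand f u v s → HasStrand f' u v s := by
    intro f f' hf hf' h u v s hs
    rcases mult_trichotomy D u v with h0 | h0 | h0
    · exact absurd hs (not_hasStrand_of_zero hf h0 s)
    · obtain ⟨i, ⟨rfl, rfl⟩ | ⟨rfl, rfl⟩⟩ := O.exists_edge h0
      · rw [hasStrand_iff hf] at hs
        rw [hasStrand_iff hf', hs, h]
      · have hs := hs.swap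
        rw [hasStrand_iff hf, h, ← hasStrand_iff hf'] at hs
        have := hs.swap
        rwa [Fin.two_sub_sub] at this
    · exact hasStrand_of_two hf' h0 s
  have hsome : ∀ u x, f.1 (u, some x) = f'.1 (u, some x) := by
    intro u x
    by_cases hx : f.1 (u, some x) = (u, none)
    · rw [hx]
      by_contra hx'
      obtain ⟨v, y, hvy⟩ := matching_some f' u x (Ne.symm hx')
      obtain ⟨s, rfl, rfl, hs⟩ := exists_hasStrand hvy
      have := key hf' hf h.symm _ _ _ hs
      rw [show f.1 _ = _ from this] at hx
      simp at hx
    · obtain ⟨v, y, hvy⟩ := matching_some f u x hx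
      obtain ⟨s, rfl, rfl, hs⟩ := exists_hasStrand hvy
      have := key hf hf' h _ _ _ hs
      exact Eq.trans hs (Eq.symm this)
  apply Subtype.ext
  funext ⟨u, x⟩
  rcases x with _ | x
  · obtain ⟨y, hy⟩ := matching_none f u
    have h1 : f.1 (u, some y) = (u, none) := by rw [← hy, f.2.2]
    rw [hsome] at h1
    rw [hy, ← h1, f'.2.2]
  · exact hsome u x

end Orientation

end

section

variable {V : Type*} [Fintype V] {G : SimpleGraph V} {c : EdgeColoring G}

namespace Orientation

variable {D : DoubleDimer G} {I : Type*} (O : Orientation D I)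

/-! ### Reconstruction of a matching from its strands -/

/-- The strand `s` of the edge from `u` to `v` is selected by `σ`. -/
def Selected (σ : I → Fin 2) (u v : V) (s : Fin 2) : Prop :=
  D.mult s(u, v) = 2 ∨ (∃ i, O.src i = u ∧ O.src (O.nxt i) = v ∧ s = σ i) ∨
    ∃ i, O.src i = v ∧ O.src (O.nxt i) = u ∧ s = 1 - σ i

variable {O}

theorem Selected.adj {σ : I → Fin 2} {u v : V} {s : Fin 2} (h : O.Selected σ u v s) :
    G.Adj u v := by
  rcases h with h | ⟨i, rfl, rfl, -⟩ | ⟨i, rfl, rfl, -⟩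
  · exact D.adj (by rw [h]; decide)
  · exact O.adj i
  · exact (O.adj i).symm

theorem Selected.swap {σ : I → Fin 2} {u v : V} {s : Fin 2} (h : O.Selected σ u v s) :
    O.Selected σ v u (1 - s) := by
  rcases h with h | ⟨i, h1, h2, h3⟩ | ⟨i, h1, h2, h3⟩
  · left; rwa [Sym2.eq_swap]
  · right; right; exact ⟨i, h1, h2, by rw [h3]⟩
  · right; left; exact ⟨i, h1, h2, by rw [h3, Fin.two_sub_sub]⟩

theorem selected_iff (σ : I → Fin 2) (i : I) (s : Fin 2) :
    O.Selected σ (O.src i) (O.src (O.nxt i)) s ↔ s = σ i := by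
  constructor
  · rintro (h | ⟨j, h1, -, h3⟩ | ⟨j, h1, h2, -⟩)
    · rw [O.mult_one] at h; exact absurd h (by decide)
    · rw [h3, O.inj h1]
    · have e1 := O.inj h1
      subst e1
      exact absurd h2 (O.ne' i)
  · intro h
    exact Or.inr (Or.inl ⟨i, rfl, rfl, h⟩)

theorem selected_ne_zero {σ : I → Fin 2} {u v : V} {s : Fin 2} (h : O.Selected σ u v s) :
    D.mult s(u, v) ≠ 0 := by
  rcases h with h | ⟨i, rfl, rfl, -⟩ | ⟨i, rfl, rfl, -⟩
  · rw [h]; decide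
  · rw [O.mult_one]; decide
  · rw [Sym2.eq_swap, O.mult_one]; decide

/-- The selected pairs of leaves. -/
def LeafPair (O : Orientation D I) (c : EdgeColoring G) (σ : I → Fin 2) (u : V) (x : ZMod 3) (v : V)
    (y : ZMod 3) : Prop :=
  ∃ s, x = leaf (c.ty u v) s ∧ y = leaf (c.ty u v) (1 - s) ∧ O.Selected σ u v s

theorem LeafPair.swap {σ : I → Fin 2} {u v : V} {x y : ZMod 3} (h : LeafPair O c σ u x v y) :
    LeafPair O c σ v y u x := by
  obtain ⟨s, rfl, rfl, hs⟩ := h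
  exact ⟨1 - s, by rw [c.symm], by rw [c.symm, Fin.two_sub_sub], hs.swap⟩

/-- Exactly two leaves of every vertex are used, once each. -/
theorem leafPair_local {σ : I → Fin 2} (hσ : O.Compatible c σ) (u : V) :
    ∃ x₁ x₂ v₁ v₂ y₁ y₂, x₁ ≠ x₂ ∧ ∀ x v y, LeafPair O c σ u x v y ↔
      (x = x₁ ∧ v = v₁ ∧ y = y₁) ∨ (x = x₂ ∧ v = v₂ ∧ y = y₂) := by
  rcases D.cases u with ⟨w, hw, hw'⟩ | ⟨w₁, w₂, -, h1, -, -⟩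
  · refine ⟨leaf (c.ty u w) 0, leaf (c.ty u w) 1, w, w, leaf (c.ty u w) 1, leaf (c.ty u w) 0,
      fun h => absurd (leaf_injective _ h) (by decide), fun x v y => ?_⟩
    constructor
    · rintro ⟨s, rfl, rfl, hs⟩
      obtain rfl : v = w := by
        by_contra hv
        exact selected_ne_zero hs (hw' v hv)
      fin_cases s <;> simp
    · rintro (⟨rfl, rfl, rfl⟩ | ⟨rfl, rfl, rfl⟩)
      · exact ⟨0, rfl, rfl, Or.inl hw⟩
      · exact ⟨1, rfl, rfl, Or.inl hw⟩
  · obtain ⟨j, rfl⟩ := O.cover u w₁ h1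
    obtain ⟨i, rfl⟩ := O.nxt.surjective j
    refine ⟨_, _, O.src i, O.src (O.nxt (O.nxt i)), leaf (O.ty c i) (σ i),
      leaf (O.ty c (O.nxt i)) (1 - σ (O.nxt i)), hσ i, fun x v y => ?_⟩
    constructor
    · rintro ⟨s, rfl, rfl, hs⟩
      rcases O.mult_src _ _ (selected_ne_zero hs) with rfl | rfl
      · right
        rw [selected_iff] at hs
        subst hs
        exact ⟨rfl, rfl, rfl⟩
      · left
        rw [Equiv.symm_apply_apply] at hs ⊢
        have hs' := hs.swap
        rw [selected_iff] at hs'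
        rw [← hs', Fin.two_sub_sub]
        exact ⟨by rw [c.symm]; rfl, rfl, by rw [c.symm]; rfl⟩
    · rintro (⟨rfl, rfl, rfl⟩ | ⟨rfl, rfl, rfl⟩)
      · refine LeafPair.swap ⟨σ i, rfl, rfl, (selected_iff σ i _).2 rfl⟩
      · exact ⟨σ (O.nxt i), rfl, rfl, (selected_iff σ _ _).2 rfl⟩

/-- The relation of the matching with the given strands. -/
def Joined (O : Orientation D I) (c : EdgeColoring G) (σ : I → Fin 2) :
    V × Option (ZMod 3) → V × Option (ZMod 3) → Prop
  | (u, some x), (v, some y) => LeafPair O c σ u x v y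
  | (u, some x), (v, none) => u = v ∧ ∀ w y, ¬ LeafPair O c σ u x w y
  | (u, none), (v, some x) => u = v ∧ ∀ w y, ¬ LeafPair O c σ u x w y
  | (_, none), (_, none) => False

theorem Joined.swap {σ : I → Fin 2} {a b : V × Option (ZMod 3)} (h : Joined O c σ a b) :
    Joined O c σ b a := by
  obtain ⟨u, _ | x⟩ := a <;> obtain ⟨v, _ | y⟩ := b
  · exact h
  · obtain ⟨rfl, h⟩ := h; exact ⟨rfl, h⟩
  · obtain ⟨rfl, h⟩ := h; exact ⟨rfl, h⟩
  · exact LeafPair.swap h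

theorem Joined.adj {σ : I → Fin 2} {a b : V × Option (ZMod 3)} (h : Joined O c σ a b) :
    (squish G c).Adj a b := by
  obtain ⟨u, _ | x⟩ := a <;> obtain ⟨v, _ | y⟩ := b
  · exact h
  · exact h.1
  · exact h.1
  · obtain ⟨s, rfl, rfl, hs⟩ := h
    exact squish_adj_leaf hs.adj s

/-- By compatibility two different leaves at each vertex are used, once each. The third leaf and the
centre have only each other as partners. -/
theorem existsUnique_joined {σ : I → Fin 2} (hσ : O.Compatible c σ) (a : V × Option (ZMod 3)) :
    ∃ b, Joined O c σ a b ∧ ∀ b', Joined O c σ a b' → b' = b := by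
  obtain ⟨u, o⟩ := a
  obtain ⟨x₁, x₂, v₁, v₂, y₁, y₂, hne, h⟩ := leafPair_local hσ u
  have hfree : ∀ x, (∀ w y, ¬ LeafPair O c σ u x w y) ↔ x ≠ x₁ ∧ x ≠ x₂ := by
    intro x
    constructor
    · intro hx
      exact ⟨fun e => hx v₁ y₁ ((h _ _ _).2 (Or.inl ⟨e, rfl, rfl⟩)),
        fun e => hx v₂ y₂ ((h _ _ _).2 (Or.inr ⟨e, rfl, rfl⟩))⟩
    · rintro ⟨h1, h2⟩ w y hxy
      rcases (h _ _ _).1 hxy with h' | h'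
      · exact h1 h'.1
      · exact h2 h'.1
  rcases o with _ | x
  · obtain ⟨z, hz1, hz2, hz⟩ := existsUnique_third x₁ x₂ hne
    refine ⟨(u, some z), ⟨rfl, (hfree z).2 ⟨hz1, hz2⟩⟩, ?_⟩
    rintro ⟨v, _ | x⟩ hb
    · exact hb.elim
    · obtain ⟨rfl, hb⟩ := hb
      rw [hz x ((hfree x).1 hb).1 ((hfree x).1 hb).2]
  · by_cases hx1 : x = x₁
    · subst hx1
      refine ⟨(v₁, some y₁), (h _ _ _).2 (Or.inl ⟨rfl, rfl, rfl⟩), ?_⟩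
      rintro ⟨v, _ | y⟩ hb
      · exact absurd rfl ((hfree x).1 hb.2).1
      · rcases (h _ _ _).1 hb with ⟨-, rfl, rfl⟩ | ⟨h', -⟩
        · rfl
        · exact absurd h' hne
    · by_cases hx2 : x = x₂
      · subst hx2
        refine ⟨(v₂, some y₂), (h _ _ _).2 (Or.inr ⟨rfl, rfl, rfl⟩), ?_⟩
        rintro ⟨v, _ | y⟩ hb
        · exact absurd rfl ((hfree x).1 hb.2).2
        · rcases (h _ _ _).1 hb with ⟨h', -⟩ | ⟨-, rfl, rfl⟩
          · exact absurd h' hx1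
          · rfl
      · refine ⟨(u, none), ⟨rfl, (hfree x).2 ⟨hx1, hx2⟩⟩, ?_⟩
        rintro ⟨v, _ | y⟩ hb
        · rw [hb.1]
        · rcases (h _ _ _).1 hb with h' | h'
          · exact absurd h'.1 hx1
          · exact absurd h'.1 hx2

/-- The matching with the given strands. -/
def toMatching {σ : I → Fin 2} (hσ : O.Compatible c σ) : Matching (squish G c) :=
  ⟨fun a => (existsUnique_joined hσ a).choose,
    fun a => (existsUnique_joined hσ a).choose_spec.1.adj,
    fun a => ((existsUnique_joined hσ _).choose_spec.2 _
      (existsUnique_joined hσ a).choose_spec.1.swap).symm⟩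

theorem toMatching_apply_eq_iff {σ : I → Fin 2} (hσ : O.Compatible c σ)
    (a b : V × Option (ZMod 3)) : (toMatching hσ).1 a = b ↔ Joined O c σ a b :=
  ⟨fun h => h ▸ (existsUnique_joined hσ a).choose_spec.1,
    fun h => ((existsUnique_joined hσ a).choose_spec.2 b h).symm⟩

theorem hasStrand_toMatching {σ : I → Fin 2} (hσ : O.Compatible c σ) (u v : V) (s : Fin 2) :
    HasStrand (toMatching hσ) u v s ↔ O.Selected σ u v s := by
  unfold HasStrand
  rw [toMatching_apply_eq_iff]
  constructor
  · rintro ⟨s', h1, -, h⟩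
    rwa [leaf_injective _ h1]
  · intro h
    exact ⟨s, rfl, rfl, h⟩

theorem squishMap_toMatching {σ : I → Fin 2} (hσ : O.Compatible c σ) :
    squishMap (toMatching hσ) = D := by
  classical
  rw [squishMap_eq_iff]
  intro u v
  unfold strandCount
  simp only [hasStrand_toMatching]
  rcases mult_trichotomy D u v with h | h | h
  · rw [h, Finset.filter_false_of_mem]
    · rfl
    · intro s _ hs
      exact selected_ne_zero hs h
  · rw [h]
    obtain ⟨i, ⟨rfl, rfl⟩ | ⟨rfl, rfl⟩⟩ := O.exists_edge h
    · simp only [selected_iff]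
      rw [Finset.filter_eq']
      simp
    · have : ∀ s, O.Selected σ (O.src (O.nxt i)) (O.src i) s ↔ s = 1 - σ i := by
        intro s
        constructor
        · intro hs
          rw [← (selected_iff σ i _).1 hs.swap, Fin.two_sub_sub]
        · rintro rfl
          exact ((selected_iff σ i _).2 rfl).swap
      simp only [this]
      rw [Finset.filter_eq']
      simp
  · rw [h, Finset.filter_true_of_mem]
    · rfl
    · intro s _
      exact Or.inl h

theorem strands_toMatching {σ : I → Fin 2} (hσ : O.Compatible c σ) :
    O.strands (toMatching hσ) = σ := by
  funext i
  have := (hasStrand_iff (O := O) (squishMap_toMatching hσ) i (σ i)).1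
    ((hasStrand_toMatching hσ _ _ _).2 ((selected_iff σ i _).2 rfl))
  exact this.symm

/-! ### Weights -/

/-- A product over the edges of oriented loops, as a product over the left vertices. -/
theorem prod_left_eq [Fintype I] (side : V → Bool) (hs : ∀ u v, G.Adj u v → side u ≠ side v)
    (q : I → ℂ) :
    ∏ i ∈ Finset.univ.filter (fun i => side (O.src i) = true), (q i * q (O.nxt.symm i)) =
      ∏ i, q i := by
  classical
  rw [Finset.prod_mul_distrib, ← Finset.prod_filter_mul_prod_filter_not Finset.univ
    (fun i => side (O.src i) = true) q]
  congr 1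
  -- The edges that end at a left vertex are the edges that start at a right vertex.
  refine Finset.prod_bij (fun i _ => O.nxt.symm i) ?_ (fun _ _ _ _ h => O.nxt.symm.injective h) ?_
    (fun _ _ => rfl)
  · intro i hi
    have h := hs _ _ (O.adj (O.nxt.symm i))
    rw [Equiv.apply_symm_apply] at h
    simp only [Finset.mem_filter, Finset.mem_univ, true_and] at hi ⊢
    rwa [hi] at h
  · intro i hi
    have h := hs _ _ (O.adj i)
    simp only [Finset.mem_filter, Finset.mem_univ, true_and] at hi
    refine ⟨O.nxt i, ?_, by simp⟩
    simp only [Finset.mem_filter, Finset.mem_univ, true_and]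
    simp only [Bool.not_eq_true] at hi
    rw [hi] at h
    cases hb : side (O.src (O.nxt i))
    · exact absurd hb.symm h
    · rfl

-- A leaf matched with the centre contributes 1; each other leaf belongs to exactly one strand at
-- `u`.
open Classical in
theorem prod_leaves (f : Matching (squish G c)) (w : Sym2 (V × Option (ZMod 3)) → ℂ)
    (hw : ∀ u x, w s((u, some x), (u, none)) = 1) (u : V) :
    ∏ x, w s((u, some x), f.1 (u, some x)) = ∏ v, ∏ s, if HasStrand f u v s then
      w s((u, some (leaf (c.ty u v) s)), (v, some (leaf (c.ty u v) (1 - s)))) else 1 := by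
  rw [← Fintype.prod_prod_type' (f := fun v s => if HasStrand f u v s then
      w s((u, some (leaf (c.ty u v) s)), (v, some (leaf (c.ty u v) (1 - s)))) else 1),
    ← Finset.prod_filter, ← Finset.prod_filter_mul_prod_filter_not Finset.univ
      (fun x => f.1 (u, some x) ≠ (u, none)), ← image_hasStrand,
    Finset.prod_image (by simpa using injOn_hasStrand f u)]
  rw [Finset.prod_eq_one (s := Finset.univ.filter fun x => ¬ f.1 (u, some x) ≠ (u, none)), mul_one]
  · refine Finset.prod_congr rfl fun p hp => ?_
    rw [show f.1 _ = _ from (Finset.mem_filter.1 hp).2]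
  · intro x hx
    have := (Finset.mem_filter.1 hx).2
    push Not at this
    rw [this, hw]

/-- The weight of a matching is the product of the weights of its strands on the loops. -/
theorem weight_eq [Fintype I] {f : Matching (squish G c)} (hf : squishMap f = D) (side : V → Bool)
    (hs : ∀ u v, G.Adj u v → side u ≠ side v) (w : Sym2 (V × Option (ZMod 3)) → ℂ)
    (hw : ∀ u x, w s((u, some x), (u, none)) = 1) (m : V → V → Fin 2 → ℂ)
    (hm : ∀ u v s, G.Adj u v →
      w s((u, some (leaf (c.ty u v) s)), (v, some (leaf (c.ty u v) (1 - s)))) = m u v s)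
    (hm1 : ∀ u v, G.Adj u v → m u v 0 * m u v 1 = 1) :
    ∏ a ∈ Finset.univ.filter (fun a => squishSide side a = true), w s(a, f.1 a) =
      ∏ i, m (O.src i) (O.src (O.nxt i)) (O.strands f i) := by
  classical
  have hms : ∀ u v s, G.Adj u v → m v u (1 - s) = m u v s := by
    intro u v s h
    rw [← hm u v s h, ← hm v u (1 - s) h.symm, Fin.two_sub_sub, c.symm v u, Sym2.eq_swap]
  have h1 : ∏ a ∈ Finset.univ.filter (fun a => squishSide side a = true), w s(a, f.1 a) =
      ∏ u ∈ Finset.univ.filter (fun u => side u = true), ∏ x, w s((u, some x), f.1 (u, some x)) := by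
    rw [Finset.prod_filter, Fintype.prod_prod_type, Finset.prod_filter]
    refine Finset.prod_congr rfl fun u _ => ?_
    rw [Fintype.prod_option]
    have : w s((u, none), f.1 (u, none)) = 1 := by
      obtain ⟨x, hx⟩ := matching_none f u
      rw [hx, Sym2.eq_swap, hw]
    rw [this]
    cases hu : side u <;> simp [squishSide, hu]
  rw [h1]
  -- A vertex of a loop meets the outgoing strand and the incoming one. The latter is seen against
  -- its direction, which exchanges the strands `s` and `1 - s`.
  have hloc : ∀ i, ∏ x, w s((O.src i, some x), f.1 (O.src i, some x)) =
      m (O.src i) (O.src (O.nxt i)) (O.strands f i) *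
        m (O.src (O.nxt.symm i)) (O.src (O.nxt (O.nxt.symm i))) (O.strands f (O.nxt.symm i)) := by
    intro i
    rw [prod_leaves f w hw, Fintype.prod_eq_mul _ _ (O.ne i)]
    · congr 1
      · rw [Fintype.prod_eq_single (O.strands f i), if_pos ((hasStrand_iff hf i _).2 rfl),
          hm _ _ _ (O.adj i)]
        intro s hs
        rw [if_neg]
        exact fun h => hs ((hasStrand_iff hf i _).1 h)
      · obtain ⟨j, rfl⟩ := O.nxt.surjective i
        rw [Equiv.symm_apply_apply]
        rw [Fintype.prod_eq_single (1 - O.strands f j),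
          if_pos ((hasStrand_iff hf j _).2 rfl).swap, hm _ _ _ (O.adj j).symm,
          hms _ _ _ (O.adj j)]
        intro s hs
        rw [if_neg]
        intro h
        apply hs
        rw [← (hasStrand_iff hf j _).1 h.swap, Fin.two_sub_sub]
    · rintro v ⟨hv1, hv2⟩
      refine Finset.prod_eq_one fun s _ => if_neg fun h => ?_
      refine not_hasStrand_of_zero hf ?_ s h
      by_contra h0
      rcases O.mult_src i v h0 with h' | h'
      · exact hv1 h'
      · exact hv2 h'
  rw [← O.prod_left_eq side hs]
  rw [← Finset.prod_congr rfl fun i _ => hloc i,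
    ← Finset.prod_image (s := Finset.univ.filter fun i => side (O.src i) = true) (g := O.src)
      (f := fun u => ∏ x, w s((u, some x), f.1 (u, some x))) (fun _ _ _ _ h => O.inj h)]
  symm
  apply Finset.prod_subset
  · intro u hu
    simp only [Finset.mem_image, Finset.mem_filter, Finset.mem_univ, true_and] at hu ⊢
    obtain ⟨i, hi, rfl⟩ := hu
    exact hi
  · intro u hu hu'
    have hnl : ∀ i, O.src i ≠ u := by
      rintro i rfl
      apply hu'
      simp only [Finset.mem_image, Finset.mem_filter, Finset.mem_univ, true_and] at hu ⊢
      exact ⟨i, hu, rfl⟩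
    rw [prod_leaves f w hw]
    -- A left vertex off the loops lies on a doubled edge, whose two strands have weights with
    -- product 1.
    rcases D.cases u with ⟨v, hv, hv'⟩ | ⟨w₁, w₂, -, h1, -, -⟩
    · rw [Fintype.prod_eq_single v]
      · have hadj : G.Adj u v := D.adj (by rw [hv]; decide)
        rw [Fin.prod_univ_two, if_pos (hasStrand_of_two hf hv _),
          if_pos (hasStrand_of_two hf hv _), hm _ _ _ hadj, hm _ _ _ hadj, hm1 _ _ hadj]
      · intro v' hv''
        exact Finset.prod_eq_one fun s _ => if_neg (not_hasStrand_of_zero hf (hv' v' hv'') s)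
    · obtain ⟨i, hi⟩ := O.cover u w₁ h1
      exact absurd hi (hnl i)

open Classical in
/-- The transfer matrix of the edge number `i` and the following turn. -/
def transfer (O : Orientation D I) (c : EdgeColoring G) (m : V → V → Fin 2 → ℂ) (i : I) :
    Matrix (Fin 2) (Fin 2) ℂ :=
  Matrix.of fun a b => if leaf (O.ty c i) (1 - b) = leaf (O.ty c (O.nxt i)) a then 0 else
    m (O.src i) (O.src (O.nxt i)) b

/-- The sum of the weights of all matchings that are squished to `D`. -/
theorem sum_fiber [Fintype I] [DecidableEq I] (O : Orientation D I) [DecidableEq (DoubleDimer G)]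
    (side : V → Bool)
    (hs : ∀ u v, G.Adj u v → side u ≠ side v) (w : Sym2 (V × Option (ZMod 3)) → ℂ)
    (hw : ∀ u x, w s((u, some x), (u, none)) = 1) (m : V → V → Fin 2 → ℂ)
    (hm : ∀ u v s, G.Adj u v →
      w s((u, some (leaf (c.ty u v) s)), (v, some (leaf (c.ty u v) (1 - s)))) = m u v s)
    (hm1 : ∀ u v, G.Adj u v → m u v 0 * m u v 1 = 1) :
    ∑ f ∈ Finset.univ.filter (fun f : Matching (squish G c) => squishMap f = D),
      ∏ a ∈ Finset.univ.filter (fun a => squishSide side a = true), w s(a, f.1 a) =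
      ∑ σ : I → Fin 2, ∏ i, O.transfer c m i (σ (O.nxt i)) (σ i) := by
  classical
  have h1 : ∀ σ : I → Fin 2, ∏ i, O.transfer c m i (σ (O.nxt i)) (σ i) =
      if O.Compatible c σ then ∏ i, m (O.src i) (O.src (O.nxt i)) (σ i) else 0 := by
    intro σ
    split_ifs with h
    · refine Finset.prod_congr rfl fun i _ => ?_
      simp only [transfer, Matrix.of_apply]
      exact if_neg (h i)
    · unfold Compatible at h
      push Not at h
      obtain ⟨i, hi⟩ := h
      refine Finset.prod_eq_zero (Finset.mem_univ i) ?_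
      simp only [transfer, Matrix.of_apply]
      exact if_pos hi
  simp only [h1]
  rw [← Finset.sum_filter]
  refine Finset.sum_bij (fun f _ => O.strands f) ?_ ?_ ?_ ?_
  · intro f hf
    rw [Finset.mem_filter] at hf ⊢
    exact ⟨Finset.mem_univ _, strands_compatible hf.2⟩
  · intro f hf f' hf' h
    exact strands_injective (Finset.mem_filter.1 hf).2 (Finset.mem_filter.1 hf').2 h
  · intro σ hσ
    have hσ' := (Finset.mem_filter.1 hσ).2
    exact ⟨toMatching hσ', by simpa using squishMap_toMatching hσ', strands_toMatching hσ'⟩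
  · intro f hf
    exact weight_eq (Finset.mem_filter.1 hf).2 side hs w hw m hm hm1

end Orientation

end

/-! ### The gauge transformation -/

/-- The powers of `L J`. -/
def gauge (t : ZMod 3) : Matrix (Fin 2) (Fin 2) ℂ :=
  if t = 0 then 1 else if t = 1 then !![0, -1; 1, -1] else !![-1, 1; -1, 0]

theorem gauge_zero : gauge 0 = 1 := rfl

theorem gauge_one : gauge 1 = !![0, -1; 1, -1] := by
  unfold gauge
  rw [if_neg (by decide), if_pos rfl]

theorem gauge_two : gauge 2 = !![-1, 1; -1, 0] := by
  unfold gauge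
  rw [if_neg (by decide), if_neg (by decide)]

theorem zmod_three_cases (t : ZMod 3) : t = 0 ∨ t = 1 ∨ t = 2 := by revert t; decide

theorem gauge_mul_gauge_neg (t : ZMod 3) : gauge t * gauge (-t) = 1 := by
  rcases zmod_three_cases t with rfl | rfl | rfl
  · simp [gauge_zero]
  · rw [show (-1 : ZMod 3) = 2 from rfl, gauge_one, gauge_two, Matrix.one_fin_two]
    simp
  · rw [show (-2 : ZMod 3) = 1 from rfl, gauge_one, gauge_two, Matrix.one_fin_two]
    simp

/-- The sign of a turn: `1` for a left turn and `-1` for a right turn. -/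
def turnSign (t t' : ZMod 3) : ℤ := if t' = t + 1 then 1 else -1

/-- At a left turn the two left strands share a leaf, at a right turn the two right ones; the
transfer matrices are thus `L` and `R` times the diagonal matrix. The identities `L = (LJ) J`, `R =
-(LJ)^2 J` and `(LJ)^3 = 1` bring both cases to a common form. -/
theorem transfer_eq_gauge (t t' : ZMod 3) (h : t ≠ t') (m : Fin 2 → ℂ) :
    (Matrix.of fun a b => if leaf t (1 - b) = leaf t' a then 0 else m b) =
      (turnSign t t' : ℂ) • (gauge t' * (gauge (-t) * (matJ * Matrix.diagonal m))) := by
  have h1 : Matrix.diagonal m = !![m 0, 0; 0, m 1] := by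
    ext i j; fin_cases i <;> fin_cases j <;> rfl
  have h2 : (Matrix.of fun a b => if leaf t (1 - b) = leaf t' a then 0 else m b) =
      if t' = t + 1 then !![0, m 1; m 0, m 1] else !![m 0, m 1; m 0, 0] := by
    revert t t'
    have key : ∀ t t' : ZMod 3, t ≠ t' → ∀ a b : Fin 2, (leaf t (1 - b) = leaf t' a ↔
        if t' = t + 1 then a = 0 ∧ b = 0 else a = 1 ∧ b = 1) := by
      unfold leaf; decide
    intro t t' h
    ext a b
    simp only [Matrix.of_apply, key t t' h]
    split_ifs <;> fin_cases a <;> fin_cases b <;> simp_all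
  rw [h2, h1]
  rcases zmod_three_cases t with rfl | rfl | rfl <;>
    rcases zmod_three_cases t' with rfl | rfl | rfl <;>
    first
    | exact absurd rfl h
    | simp only [turnSign]
      first
      | rw [if_pos (by decide), if_pos (by decide)]
        simp only [show (-1 : ZMod 3) = 2 from rfl, show (-2 : ZMod 3) = 1 from rfl, neg_zero,
          gauge_zero, gauge_one, gauge_two, matJ]
        simp
      | rw [if_neg (by decide), if_neg (by decide)]
        simp only [show (-1 : ZMod 3) = 2 from rfl, show (-2 : ZMod 3) = 1 from rfl, neg_zero,
          gauge_zero, gauge_one, gauge_two, matJ]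
        simp

section

variable {V : Type*} [Fintype V] {G : SimpleGraph V} {c : EdgeColoring G}

/-- The colour of an edge of a loop. -/
def LoopParam.ty {D : DoubleDimer G} (P : LoopParam D) (c : EdgeColoring G) (k : ZMod P.n) :
    ZMod 3 :=
  c.ty (P.vert k) (P.vert (k + 1))

theorem LoopParam.ty_ne {D : DoubleDimer G} (P : LoopParam D) (c : EdgeColoring G)
    (k : ZMod P.n) : P.ty c k ≠ P.ty c (k + 1) := by
  intro h
  unfold LoopParam.ty at h
  rw [c.symm] at h
  have h1 := c.inj _ _ _ (P.adj k).symm (P.adj (k + 1)) h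
  have := P.vert_succ_ne (k + 1)
  rw [add_sub_cancel_right] at this
  exact this h1.symm

/-- The orientation of all loops given by the parametrizations. -/
def loopOrientation (D : DoubleDimer G) :
    Orientation D (Σ ℓ : {ℓ : Finset (Sym2 V) // D.IsLoop ℓ}, ZMod (loopParam D ℓ).n) where
  src i := (loopParam D i.1).vert i.2
  nxt := Equiv.sigmaCongrRight fun _ => Equiv.addRight 1
  inj := by
    rintro ⟨ℓ, k⟩ ⟨ℓ', k'⟩ h
    exact loopParam_inj D ℓ ℓ' k k' h
  mult_one i := (loopParam D i.1).mult_one i.2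
  ne i := by
    have := (loopParam D i.1).vert_succ_ne i.2
    rw [sub_eq_add_neg] at this
    exact this
  mult_src i w h := by
    have := (loopParam D i.1).mult_vert i.2 w h
    rw [sub_eq_add_neg] at this
    exact this
  cover v w h := by
    obtain ⟨ℓ, k, hk⟩ := exists_loopParam D h
    exact ⟨⟨ℓ, k⟩, hk⟩

open Classical in
/-- The product of the traces of the transfer matrices along all loops. -/
theorem sum_transfer_eq_prod_trace (D : DoubleDimer G) (m : V → V → Fin 2 → ℂ) :
    ∑ σ : (Σ ℓ : {ℓ : Finset (Sym2 V) // D.IsLoop ℓ}, ZMod (loopParam D ℓ).n) → Fin 2,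
      ∏ i, (loopOrientation D).transfer c m i (σ ((loopOrientation D).nxt i)) (σ i) =
    ∏ ℓ : {ℓ : Finset (Sym2 V) // D.IsLoop ℓ},
      (orderedProd (fun k : ℕ => (loopOrientation D).transfer c m ⟨ℓ, k⟩)
        (loopParam D ℓ).n).trace := by
  have h1 : ∀ ℓ : {ℓ : Finset (Sym2 V) // D.IsLoop ℓ},
      (orderedProd (fun k : ℕ => (loopOrientation D).transfer c m ⟨ℓ, k⟩)
        (loopParam D ℓ).n).trace = ∑ s : ZMod (loopParam D ℓ).n → Fin 2,
          ∏ k, (loopOrientation D).transfer c m ⟨ℓ, k⟩ (s (k + 1)) (s k) :=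
    fun ℓ => trace_orderedProd _ fun k => (loopOrientation D).transfer c m ⟨ℓ, k⟩
  simp only [h1]
  rw [Finset.prod_univ_sum, Fintype.piFinset_univ, ← (Equiv.piCurry _).sum_comp]
  refine Finset.sum_congr rfl fun σ _ => ?_
  rw [Fintype.prod_sigma]
  rfl

/-- A product over the vertices of a loop that takes opposite values on the two sides. -/
theorem LoopParam.prod_side {D : DoubleDimer G} (P : LoopParam D) (side : V → Bool)
    (hs : ∀ u v, G.Adj u v → side u ≠ side v) (x y : ℂ) (hxy : x * y = 1) :
    ∏ k, (if side (P.vert k) = true then x else y) = 1 := by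
  classical
  rw [Finset.prod_ite, Finset.prod_const, Finset.prod_const]
  have : (Finset.univ.filter fun k => ¬ side (P.vert k) = true).card =
      (Finset.univ.filter fun k => side (P.vert k) = true).card := by
    refine Finset.card_bij' (fun k _ => k + 1) (fun k _ => k - 1) ?_ ?_ (by simp) (by simp)
    · intro k hk
      rw [Finset.mem_filter] at hk ⊢
      have := hs _ _ (P.adj k)
      refine ⟨Finset.mem_univ _, ?_⟩
      cases h : side (P.vert (k + 1)) <;> simp_all
    · intro k hk
      rw [Finset.mem_filter] at hk ⊢
      have := hs _ _ (P.adj (k - 1))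
      rw [sub_add_cancel] at this
      refine ⟨Finset.mem_univ _, ?_⟩
      cases h : side (P.vert (k - 1)) <;> simp_all
  rw [this, ← mul_pow, hxy, one_pow]

theorem prod_range_loop {D : DoubleDimer G} (P : LoopParam D) (q : ZMod P.n → ℂ) (h : ∏ k, q k = 1) :
    ∏ k ∈ Finset.range P.n, q k = 1 := by
  rw [prod_range_eq_prod_zmod, h]

/-- The turn signs cancel by `hturn`. The gauge factor to the left of each edge moves cyclically to
the right of the next one, and the factors `i` and `-i` can be inserted because the loop visits both
sides equally often. -/
theorem LoopParam.trace_transfer {D : DoubleDimer G} (P : LoopParam D) (side : V → Bool)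
    (hs : ∀ u v, G.Adj u v → side u ≠ side v) (m : V → V → Fin 2 → ℂ)
    (hturn : ∏ k, turnSign (P.ty c k) (P.ty c (k + 1)) = 1) :
    (orderedProd (fun k : ℕ => Matrix.of fun a b =>
      if leaf (P.ty c k) (1 - b) = leaf (P.ty c ((k : ZMod P.n) + 1)) a then 0
      else m (P.vert k) (P.vert ((k : ZMod P.n) + 1)) b) P.n).trace =
    (orderedProd (fun k : ℕ => (if side (P.vert k) = true then Complex.I else -Complex.I) •
      (gauge (-P.ty c k) * (matJ * Matrix.diagonal (m (P.vert k) (P.vert ((k : ZMod P.n) + 1)))) *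
        gauge (P.ty c k))) P.n).trace := by
  let q : ZMod P.n → ℂ := fun k => turnSign (P.ty c k) (P.ty c (k + 1))
  let Y : ZMod P.n → Matrix (Fin 2) (Fin 2) ℂ := fun k => gauge (-P.ty c k) *
    (matJ * Matrix.diagonal (m (P.vert k) (P.vert (k + 1))))
  have hq : ∏ k, q k = 1 := by simp only [q]; exact_mod_cast hturn
  have h1 : (fun k : ℕ => (Matrix.of fun a b =>
      if leaf (P.ty c k) (1 - b) = leaf (P.ty c ((k : ZMod P.n) + 1)) a then 0
      else m (P.vert k) (P.vert ((k : ZMod P.n) + 1)) b)) = fun k : ℕ =>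
      q k • (gauge (P.ty c ((k + 1 : ℕ) : ZMod P.n)) * Y k) := by
    funext k
    push_cast
    exact transfer_eq_gauge _ _ (P.ty_ne c k) _
  rw [h1, orderedProd_smul, prod_range_loop P q hq, one_smul,
    trace_orderedProd_gauge P.n Y (fun k => gauge (P.ty c k))
        (fun k => gauge (-P.ty c k)) (fun k => gauge_mul_gauge_neg _)]
  rw [orderedProd_smul (fun k : ℕ =>
    if side (P.vert k) = true then Complex.I else -Complex.I), prod_range_loop P
    (fun k => if side (P.vert k) = true then Complex.I else -Complex.I)
    (P.prod_side side hs _ _ (by simp)), one_smul]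

/-- If all loops have an even number of right turns, the squish map relates the single and the
double dimer partition functions. -/
theorem dimerPartition_squish (side : V → Bool) (hs : ∀ u v, G.Adj u v → side u ≠ side v)
    (w : Sym2 (V × Option (ZMod 3)) → ℂ)
    (hw : ∀ u x, w s((u, some x), (u, none)) = 1) (m : V → V → Fin 2 → ℂ)
    (hm : ∀ u v s, G.Adj u v →
      w s((u, some (leaf (c.ty u v) s)), (v, some (leaf (c.ty u v) (1 - s)))) = m u v s)
    (hm1 : ∀ u v, G.Adj u v → m u v 0 * m u v 1 = 1) (Γ : SL2Connection G)
    (hΓ : ∀ d, (Γ.mat d : Matrix (Fin 2) (Fin 2) ℂ) =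
      (if side d.fst = true then Complex.I else -Complex.I) • (gauge (-c.ty d.fst d.snd) *
        (matJ * Matrix.diagonal (m d.fst d.snd)) * gauge (c.ty d.fst d.snd)))
    (hturn : ∀ (D : DoubleDimer G) (P : LoopParam D),
      ∏ k, turnSign (P.ty c k) (P.ty c (k + 1)) = 1) :
    dimerPartition (squish G c) w = doubleDimerPartition G (fun _ => 1) Γ := by
  classical
  rw [dimerPartition_eq_sum_matching _ w (squishSide side) (squish_side side hs),
    ← Finset.sum_fiberwise _ (fun f : Matching (squish G c) => squishMap f), doubleDimerPartition]
  refine Finset.sum_congr rfl fun D _ => ?_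
  rw [(loopOrientation D).sum_fiber side hs w hw m hm hm1, sum_transfer_eq_prod_trace]
  unfold DoubleDimer.contribution
  simp only [one_pow, Finset.prod_const_one, one_mul]
  refine Finset.prod_congr (by congr) fun ℓ _ => ?_
  rw [loopTrace_eq Γ (fun u v => (if side u = true then Complex.I else -Complex.I) •
    (gauge (-c.ty u v) * (matJ * Matrix.diagonal (m u v)) * gauge (c.ty u v))) hΓ]
  exact (loopParam D ℓ).trace_transfer side hs m (hturn D _)

end

/-! ### The number of right turns of a loop is even -/

section

variable {V : Type*} {G : SimpleGraph V} {c : EdgeColoring G}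

/-- The matching of the squished graph that contains both strands of every edge of `f`. -/
def doubledMatching (c : EdgeColoring G) (f : Matching G) : Matching (squish G c) :=
  ⟨fun
    | (u, none) => (u, some (c.ty u (f.1 u)))
    -- The three colours add up to 0, so `-(x + t)` is the colour other than `x` and `t`, where the
    -- strand that starts at the leaf `x` ends.
    | (u, some x) => if x = c.ty u (f.1 u) then (u, none)
        else (f.1 u, some (-(x + c.ty u (f.1 u)))), by
    have key : ∀ x t : ZMod 3, x ≠ t → -(x + t) ≠ t ∧ x ≠ -(x + t) := by decide
    rintro ⟨u, _ | x⟩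
    · exact rfl
    · simp only
      split_ifs with h
      · exact rfl
      · exact ⟨f.2.1 u, h, (key _ _ h).1, (key _ _ h).2⟩, by
    have key : ∀ x t : ZMod 3, x ≠ t → -(x + t) ≠ t ∧ -(-(x + t) + t) = x := by decide
    rintro ⟨u, _ | x⟩
    · simp only [if_pos]
    · by_cases h : x = c.ty u (f.1 u)
      · simp only [if_pos h]
        rw [h]
      · simp only [if_neg h]
        rw [f.2.2 u, c.symm (f.1 u) u, if_neg (key _ _ h).1, (key _ _ h).2]⟩

theorem doubledMatching_none (f : Matching G) (u : V) :
    (doubledMatching c f).1 (u, none) = (u, some (c.ty u (f.1 u))) := rfl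

theorem doubledMatching_some (f : Matching G) (u : V) (x : ZMod 3) :
    (doubledMatching c f).1 (u, some x) = if x = c.ty u (f.1 u) then (u, none)
        else (f.1 u, some (-(x + c.ty u (f.1 u)))) := rfl

open Classical in
/-- The vertices of the left strand of a closed walk `u` that belong to the same class as `u 0`,
between `u (2 * j)` and `u (2 * j + 2)`. -/
def strandChunk (c : EdgeColoring G) (u : ℕ → V) (j : ℕ) : List (V × Option (ZMod 3)) :=
  (if c.ty (u (2 * j + 1)) (u (2 * j + 2)) = c.ty (u (2 * j)) (u (2 * j + 1)) + 1 then []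
    else [(u (2 * j + 1), none)]) ++
  ((if c.ty (u (2 * j + 2)) (u (2 * j + 3)) = c.ty (u (2 * j + 1)) (u (2 * j + 2)) + 1 then []
    else [(u (2 * j + 2), some (c.ty (u (2 * j + 1)) (u (2 * j + 2)) + 2))]) ++
  [(u (2 * j + 2), some (c.ty (u (2 * j + 2)) (u (2 * j + 3)) + 1))])

theorem strandChunk_fst {u : ℕ → V} {j : ℕ} {a : V × Option (ZMod 3)}
    (ha : a ∈ strandChunk c u j) : a.1 = u (2 * j + 1) ∧ a.2 = none ∨ a.1 = u (2 * j + 2) ∧ a.2 ≠ none := by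
  unfold strandChunk at ha
  split_ifs at ha <;> simp at ha <;> grind

theorem strandChunk_nodup {u : ℕ → V} {j : ℕ}
    (hne : c.ty (u (2 * j + 1)) (u (2 * j + 2)) ≠ c.ty (u (2 * j + 2)) (u (2 * j + 3))) :
    (strandChunk c u j).Nodup := by
  have key : ∀ t t' : ZMod 3, t ≠ t' → t' ≠ t + 1 → t + 2 ≠ t' + 1 := by decide
  unfold strandChunk
  split_ifs with h1 h2 h2
  · simp
  · simp [key _ _ hne h2]
  · simp
  · simp [key _ _ hne h2]

/-- A chunk has one vertex, plus one for each right turn among its two turns: the centre at `u (2 *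
j + 1)` and a second leaf at `u (2 * j + 2)`. -/
theorem neg_one_pow_length_strandChunk (u : ℕ → V) (j : ℕ) :
    (-1 : ℤ) ^ (strandChunk c u j).length =
      -(turnSign (c.ty (u (2 * j)) (u (2 * j + 1))) (c.ty (u (2 * j + 1)) (u (2 * j + 2))) *
        turnSign (c.ty (u (2 * j + 1)) (u (2 * j + 2))) (c.ty (u (2 * j + 2)) (u (2 * j + 3)))) := by
  unfold strandChunk turnSign
  split_ifs <;> simp

/-- Consecutive vertices of the left strand alternate with respect to the doubled matching. -/
theorem strandChunk_isChain (f : Matching G) {u : ℕ → V} (hadj : ∀ j, G.Adj (u j) (u (j + 1)))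
    (hne : ∀ j, c.ty (u j) (u (j + 1)) ≠ c.ty (u (j + 1)) (u (j + 2)))
    (hf : ∀ j, f.1 (u (2 * j + 1)) = u (2 * j + 2)) (j : ℕ) :
    ((u (2 * j), some (c.ty (u (2 * j)) (u (2 * j + 1)) + 1)) :: strandChunk c u j).IsChain
      (fun a b => (squish G c).Adj a ((doubledMatching c f).1 b)) := by
  have hf' : f.1 (u (2 * j + 2)) = u (2 * j + 1) := by rw [← hf j, f.2.2]
  have hA := hadj (2 * j)
  have h01 := hne (2 * j)
  have h12 := hne (2 * j + 1)
  rw [show 2 * j + 1 + 1 = 2 * j + 2 from rfl, show 2 * j + 1 + 2 = 2 * j + 3 from rfl] at h12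
  unfold strandChunk
  have hsymm : c.ty (u (2 * j + 2)) (u (2 * j + 1)) = c.ty (u (2 * j + 1)) (u (2 * j + 2)) :=
    c.symm _ _
  set t0 := c.ty (u (2 * j)) (u (2 * j + 1)) with ht0
  set t1 := c.ty (u (2 * j + 1)) (u (2 * j + 2)) with ht1
  set t2 := c.ty (u (2 * j + 2)) (u (2 * j + 3)) with ht2
  have hcen : (doubledMatching c f).1 (u (2 * j + 1), none) = (u (2 * j + 1), some t1) := by
    rw [doubledMatching_none, hf]
  have hin : (doubledMatching c f).1 (u (2 * j + 2), some (t1 + 2)) =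
      (u (2 * j + 1), some (t1 + 1)) := by
    have k1 : ∀ t : ZMod 3, t + 2 ≠ t ∧ -(t + 2 + t) = t + 1 := by decide
    rw [doubledMatching_some, hf', hsymm, if_neg (k1 t1).1, (k1 t1).2]
  have hout : t2 ≠ t1 + 1 → (doubledMatching c f).1 (u (2 * j + 2), some (t2 + 1)) =
      (u (2 * j + 2), none) := by
    intro h
    have k1 : ∀ t t' : ZMod 3, t ≠ t' → t' ≠ t + 1 → t' + 1 = t := by decide
    rw [doubledMatching_some, hf', hsymm, if_pos (k1 _ _ h12 h)]
  have hout' : t2 = t1 + 1 → (doubledMatching c f).1 (u (2 * j + 2), some (t2 + 1)) =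
      (u (2 * j + 1), some (t1 + 1)) := by
    intro h
    rw [h, ← hin, add_assoc]
    rfl
  have hfirst : t1 = t0 + 1 → (squish G c).Adj (u (2 * j), some (t0 + 1))
      (u (2 * j + 1), some (t1 + 1)) := by
    intro h
    have k1 : ∀ t : ZMod 3, t + 1 ≠ t ∧ t + 1 + 1 ≠ t ∧ t + 1 ≠ t + 1 + 1 := by decide
    rw [h]
    exact ⟨hA, (k1 t0).1, (k1 t0).2.1, (k1 t0).2.2⟩
  have hfirst' : t1 ≠ t0 + 1 → (squish G c).Adj (u (2 * j), some (t0 + 1))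
      (u (2 * j + 1), some t1) := by
    intro h
    have k1 : ∀ t : ZMod 3, t + 1 ≠ t := by decide
    exact ⟨hA, k1 t0, h01.symm, h.symm⟩
  split_ifs with h1 h2 h2 <;>
    simp only [List.nil_append, List.cons_append, List.isChain_cons_cons, List.isChain_singleton,
      and_true]
  · rw [hout' h2]; exact hfirst h1
  · rw [hin, hout h2]
    exact ⟨hfirst h1, rfl⟩
  · rw [hcen, hout' h2]
    exact ⟨hfirst' h1, rfl⟩
  · rw [hcen, hin, hout h2]
    exact ⟨hfirst' h1, rfl, rfl⟩

theorem strandChunk_getLast (u : ℕ → V) (j : ℕ) (h : strandChunk c u j ≠ []) :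
    (strandChunk c u j).getLast h =
      (u (2 * j + 2), some (c.ty (u (2 * j + 2)) (u (2 * j + 3)) + 1)) := by
  simp [strandChunk]

theorem strandChunk_ne_nil (u : ℕ → V) (j : ℕ) : strandChunk c u j ≠ [] := by
  simp [strandChunk]

/-- The vertices of the left strand on the side of `u 0`, in order. -/
def strandList (c : EdgeColoring G) (u : ℕ → V) (m : ℕ) : List (V × Option (ZMod 3)) :=
  (List.range m).flatMap (strandChunk c u)

theorem strandList_succ (u : ℕ → V) (m : ℕ) :
    strandList c u (m + 1) = strandList c u m ++ strandChunk c u m := by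
  simp [strandList, List.range_succ]

theorem strandList_getLast (u : ℕ → V) (m : ℕ) :
    ((u 0, some (c.ty (u 0) (u 1) + 1)) :: strandList c u m).getLast (List.cons_ne_nil _ _) =
      (u (2 * m), some (c.ty (u (2 * m)) (u (2 * m + 1)) + 1)) := by
  cases m with
  | zero => rfl
  | succ m =>
    simp only [strandList_succ, ← List.cons_append]
    rw [List.getLast_append_of_ne_nil _ (strandChunk_ne_nil u m), strandChunk_getLast]
    rfl

theorem strandList_isChain (f : Matching G) {u : ℕ → V} (hadj : ∀ j, G.Adj (u j) (u (j + 1)))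
    (hne : ∀ j, c.ty (u j) (u (j + 1)) ≠ c.ty (u (j + 1)) (u (j + 2)))
    (hf : ∀ j, f.1 (u (2 * j + 1)) = u (2 * j + 2)) (m : ℕ) :
    ((u 0, some (c.ty (u 0) (u 1) + 1)) :: strandList c u m).IsChain
      (fun a b => (squish G c).Adj a ((doubledMatching c f).1 b)) := by
  induction m with
  | zero => simp [strandList]
  | succ m ih =>
    rw [strandList_succ, ← List.cons_append]
    have h := strandChunk_isChain (c := c) f hadj hne hf m
    rw [List.isChain_append]
    refine ⟨ih, h.tail, ?_⟩
    intro x hx y hy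
    rw [List.getLast?_eq_some_getLast (List.cons_ne_nil _ _), Option.mem_some_iff,
      strandList_getLast] at hx
    subst hx
    obtain ⟨y', l, hl⟩ := List.exists_cons_of_ne_nil (strandChunk_ne_nil (c := c) u m)
    rw [hl] at hy h
    simp only [List.head?_cons, Option.mem_some_iff] at hy
    subst hy
    exact (List.isChain_cons_cons.1 h).1

/-- The list has `m` vertices plus one for each right turn, so adding `m` leaves the parity of the
number of right turns. -/
theorem neg_one_pow_length_strandList (u : ℕ → V) (m : ℕ) :
    (-1 : ℤ) ^ ((strandList c u m).length + m) = ∏ j ∈ Finset.range (2 * m),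
      turnSign (c.ty (u j) (u (j + 1))) (c.ty (u (j + 1)) (u (j + 2))) := by
  induction m with
  | zero => simp [strandList]
  | succ m ih =>
    rw [strandList_succ, List.length_append, show 2 * (m + 1) = 2 * m + 1 + 1 by ring,
      Finset.prod_range_succ, Finset.prod_range_succ, ← ih]
    have := neg_one_pow_length_strandChunk (c := c) u m
    rw [show (strandList c u m).length + (strandChunk c u m).length + (m + 1) =
      (strandList c u m).length + m + ((strandChunk c u m).length + 1) by ring, pow_add, pow_succ,
      this]
    ring_nf

/-- An alternating closed walk has an even number of right turns. -/
theorem prod_turnSign_of_alternating (side : V → Bool) (hs : ∀ u v, G.Adj u v → side u ≠ side v)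
    (hG : Coherent G side) (hG' : Coherent (squish G c) (squishSide side)) (f : Matching G)
    {u : ℕ → V} {m : ℕ} (hm : 0 < m) (hper : ∀ j, u (j + 2 * m) = u j)
    (hinj : ∀ a b, a < 2 * m → b < 2 * m → u (a + 1) = u (b + 1) → a = b)
    (hadj : ∀ j, G.Adj (u j) (u (j + 1)))
    (hne : ∀ j, c.ty (u j) (u (j + 1)) ≠ c.ty (u (j + 1)) (u (j + 2)))
    (hf : ∀ j, f.1 (u (2 * j + 1)) = u (2 * j + 2)) (h0 : side (u 0) = true) :
    ∏ j ∈ Finset.range (2 * m),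
      turnSign (c.ty (u j) (u (j + 1))) (c.ty (u (j + 1)) (u (j + 2))) = 1 := by
  have hf' : ∀ j, f.1 (u (2 * j + 2)) = u (2 * j + 1) := fun j => by rw [← hf j, f.2.2]
  have hside : ∀ j, side (u (2 * j)) = true ∧ side (u (2 * j + 1)) = false := by
    intro j
    induction j with
    | zero =>
      refine ⟨h0, ?_⟩
      have := hs _ _ (hadj 0)
      rw [h0] at this
      simpa using this
    | succ j ih =>
      have h1 := hs _ _ (hadj (2 * j + 1))
      have h2 := hs _ _ (hadj (2 * j + 2))
      rw [ih.2] at h1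
      have h3 : side (u (2 * j + 2)) = true := by simpa using h1
      rw [h3] at h2
      refine ⟨h3, ?_⟩
      change side (u (2 * j + 2 + 1)) = false
      simpa using h2
  have hper0 : u (2 * m) = u 0 := by simpa using hper 0
  have hper1 : u (2 * m + 1) = u 1 := by simpa [add_comm] using hper 1
  -- the loop itself
  have hodd : Odd m := by
    have h1 := hG f ((List.range m).map fun j => u (2 * j + 2)) (by simp; omega) ?_ ?_ ?_ ?_
    · simpa using h1
    · rw [List.nodup_map_iff_inj_on List.nodup_range]
      intro a ha b hb hab
      rw [List.mem_range] at ha hb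
      have := hinj (2 * a + 1) (2 * b + 1) (by omega) (by omega) hab
      omega
    · intro v hv
      obtain ⟨j, -, rfl⟩ := List.mem_map.1 hv
      exact (hside (j + 1)).1
    · rw [List.isChain_iff_getElem]
      intro i hi
      simp only [List.getElem_map, List.getElem_range]
      rw [hf']
      exact hadj (2 * i + 2)
    · rw [List.getLast_map, List.head_map, List.getLast_range, List.head_range]
      rw [hf', show 2 * (m - 1) + 2 = 2 * m by omega, hper0]
      exact hadj 0
  -- its left strand
  have hodd' : Odd (strandList c u m).length := by
    have hch := strandList_isChain (c := c) f hadj hne hf m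
    have hlast := strandList_getLast (c := c) u m
    have hnil : strandList c u m ≠ [] := by
      obtain ⟨k, rfl⟩ : ∃ k, m = k + 1 := ⟨m - 1, by omega⟩
      rw [strandList_succ]
      exact List.append_ne_nil_of_right_ne_nil _ (strandChunk_ne_nil u k)
    refine hG' (doubledMatching c f) _ hnil ?_ ?_ hch.tail ?_
    · unfold strandList
      rw [List.nodup_flatMap]
      refine ⟨fun j _ => strandChunk_nodup (hne (2 * j + 1)), ?_⟩
      refine List.nodup_range.pairwise_of_forall_ne ?_
      intro i hi j hj hij a ha hb
      rw [List.mem_range] at hi hj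
      rcases strandChunk_fst ha with ⟨h1, h1'⟩ | ⟨h1, h1'⟩ <;>
        rcases strandChunk_fst hb with ⟨h2, h2'⟩ | ⟨h2, h2'⟩
      · have := hinj (2 * i) (2 * j) (by omega) (by omega) (h1.symm.trans h2)
        omega
      · exact h2' h1'
      · exact h1' h2'
      · have := hinj (2 * i + 1) (2 * j + 1) (by omega) (by omega) (h1.symm.trans h2)
        omega
    · intro a ha
      obtain ⟨j, -, hj⟩ := List.mem_flatMap.1 ha
      obtain ⟨v, o⟩ := a
      rcases strandChunk_fst hj with ⟨h1, h1'⟩ | ⟨h1, h1'⟩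
      · simp only at h1 h1'
        subst h1 h1'
        simp [squishSide, (hside j).2]
      · simp only at h1 h1'
        subst h1
        obtain ⟨x, rfl⟩ := Option.ne_none_iff_exists'.1 h1'
        exact (hside (j + 1)).1
    · rw [List.getLast_cons hnil, hper0, hper1] at hlast
      rw [hlast]
      obtain ⟨y, l, hl⟩ := List.exists_cons_of_ne_nil hnil
      simp only [hl] at hch ⊢
      exact (List.isChain_cons_cons.1 hch).1
  rw [← neg_one_pow_length_strandList, (hodd'.add_odd hodd).neg_one_pow]

end

section

variable {V : Type*} [Fintype V] {G : SimpleGraph V} {c : EdgeColoring G}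

/-! ### Alternating matchings and reversal of loops -/

/-- Every double dimer configuration on a bipartite graph contains a perfect matching. -/
theorem DoubleDimer.exists_matching (D : DoubleDimer G) (side : V → Bool)
    (hs : ∀ u v, G.Adj u v → side u ≠ side v) :
    ∃ f : Matching G, ∀ v, D.mult s(v, f.1 v) ≠ 0 := by
  classical
  have hside : ∀ {u v}, D.mult s(u, v) ≠ 0 → side v = !side u := by
    intro u v h
    have := hs u v (D.adj h)
    cases h1 : side u <;> cases h2 : side v <;> simp_all
  have hswap : ∀ u v, D.mult s(u, v) = D.mult s(v, u) := fun u v => by rw [Sym2.eq_swap]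
  -- double counting
  have hcount : ∀ A B : Finset V, (∀ a ∈ A, ∀ b, D.mult s(a, b) ≠ 0 → b ∈ B) → A.card ≤ B.card := by
    intro A B hAB
    have h1 : ∑ a ∈ A, ∑ b ∈ B, (D.mult s(a, b) : ℕ) = ∑ a ∈ A, 2 := by
      refine Finset.sum_congr rfl fun a ha => ?_
      rw [← D.degree_eq_two a]
      refine Finset.sum_subset (Finset.subset_univ _) fun b _ hb => ?_
      by_contra h
      exact hb (hAB a ha b fun h' => h (by rw [h']; rfl))
    have h2 : ∑ a ∈ A, ∑ b ∈ B, (D.mult s(a, b) : ℕ) ≤ ∑ b ∈ B, 2 := by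
      rw [Finset.sum_comm]
      refine Finset.sum_le_sum fun b _ => ?_
      rw [← D.degree_eq_two b]
      refine (Finset.sum_le_sum_of_subset (Finset.subset_univ A)).trans (le_of_eq ?_)
      exact Finset.sum_congr rfl fun a _ => by rw [hswap]
    rw [h1] at h2
    simp only [Finset.sum_const, smul_eq_mul] at h2
    omega
  -- Hall's condition is the double count `hcount`. Applied to the two sides as a whole, it also
  -- shows that they are equally large, so the injection found here is a bijection.
  obtain ⟨g, hg, hg'⟩ := (Finset.all_card_le_biUnion_card_iff_exists_injective
    (fun a : {v // side v = true} => Finset.univ.filter fun b => D.mult s(a.1, b) ≠ 0)).1 (by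
      intro s
      rw [← Finset.card_map (Function.Embedding.subtype _)]
      apply hcount
      intro a ha b hb
      obtain ⟨a', ha', rfl⟩ := Finset.mem_map.1 ha
      rw [Finset.mem_biUnion]
      exact ⟨a', ha', by simpa using hb⟩)
  have hg'' : ∀ a, D.mult s(a.1, g a) ≠ 0 := fun a => (Finset.mem_filter.1 (hg' a)).2
  let g' : {v // side v = true} → {v // side v = false} := fun a =>
    ⟨g a, by rw [hside (hg'' a), a.2]; rfl⟩
  have hcard : Fintype.card {v // side v = true} = Fintype.card {v // side v = false} := by
    rw [Fintype.card_subtype, Fintype.card_subtype]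
    apply le_antisymm
    · refine hcount _ _ fun a ha b hb => ?_
      have := hside hb
      simp_all
    · refine hcount _ _ fun a ha b hb => ?_
      have := hside hb
      simp_all
  have hbij : Function.Bijective g' := by
    rw [Fintype.bijective_iff_injective_and_card]
    exact ⟨fun a b h => hg (congrArg Subtype.val h), hcard⟩
  let e := Equiv.ofBijective g' hbij
  let f : V → V := fun v => if h : side v = true then (e ⟨v, h⟩).1
    else (e.symm ⟨v, by simpa using h⟩).1
  have hf : ∀ v, D.mult s(v, f v) ≠ 0 := by
    intro v
    simp only [f]
    split_ifs with h
    · exact hg'' ⟨v, h⟩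
    · rw [hswap]
      have h1 := hg'' (e.symm ⟨v, by simpa using h⟩)
      have h2 : g (e.symm ⟨v, by simpa using h⟩) = v :=
        congrArg Subtype.val (e.apply_symm_apply ⟨v, by simpa using h⟩)
      rwa [h2] at h1
  refine ⟨⟨f, fun v => D.adj (hf v), fun v => ?_⟩, hf⟩
  by_cases h : side v = true
  · have h1 : f v = (e ⟨v, h⟩).1 := dif_pos h
    have h2 : ¬ side (f v) = true := by rw [h1, (e ⟨v, h⟩).2]; simp
    have h3 : f (f v) = (e.symm ⟨f v, by simpa using h2⟩).1 := dif_neg h2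
    rw [h3]
    have h4 : (⟨f v, by simpa using h2⟩ : {v // side v = false}) = e ⟨v, h⟩ := Subtype.ext h1
    rw [h4, Equiv.symm_apply_apply]
  · have h1 : f v = (e.symm ⟨v, by simpa using h⟩).1 := dif_neg h
    have h2 : side (f v) = true := by rw [h1]; exact (e.symm _).2
    have h3 : f (f v) = (e ⟨f v, h2⟩).1 := dif_pos h2
    rw [h3]
    have h4 : (⟨f v, h2⟩ : {v // side v = true}) = e.symm ⟨v, by simpa using h⟩ := Subtype.ext h1
    rw [h4, Equiv.apply_symm_apply]

/-- A loop, traversed in the opposite direction. -/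
def LoopParam.reverse {D : DoubleDimer G} (P : LoopParam D) : LoopParam D where
  n := P.n
  three_le := P.three_le
  vert k := P.vert (-k)
  inj := fun _ _ h => neg_injective (P.inj h)
  mult_one k := by
    have := P.mult_one (-(k + 1))
    rw [Sym2.eq_swap]
    convert this using 4
    ring

theorem turnSign_swap (t t' : ZMod 3) (h : t ≠ t') : turnSign t' t = -turnSign t t' := by
  revert t t'; unfold turnSign; decide

theorem LoopParam.even_n {D : DoubleDimer G} (P : LoopParam D) (side : V → Bool)
    (hs : ∀ u v, G.Adj u v → side u ≠ side v) : Even P.n := by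
  have h : ∀ j : ℕ, side (P.vert (j : ZMod P.n)) = side (P.vert 0) ↔ Even j := by
    intro j
    induction j with
    | zero => simp
    | succ j ih =>
      have h1 := hs _ _ (P.adj (j : ZMod P.n))
      push_cast
      rw [Nat.even_add_one, ← ih]
      revert h1
      cases side (P.vert (j : ZMod P.n)) <;> cases side (P.vert ((j : ZMod P.n) + 1)) <;>
        cases side (P.vert 0) <;> simp
  rw [← h, ZMod.natCast_self]

/-- Reversal exchanges left and right turns, so each of the evenly many factors changes sign. This
allows the direction of a loop to be chosen to suit the matching. -/
theorem LoopParam.prod_turnSign_reverse {D : DoubleDimer G} (P : LoopParam D) (c : EdgeColoring G)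
    (hn : Even P.n) :
    ∏ k, turnSign (P.reverse.ty c k) (P.reverse.ty c (k + 1)) =
      ∏ k, turnSign (P.ty c k) (P.ty c (k + 1)) := by
  have h1 : ∀ k : ZMod P.n, P.reverse.ty c k = P.ty c (-k - 1) := by
    intro k
    change c.ty (P.vert (-k)) (P.vert (-(k + 1))) = c.ty (P.vert (-k - 1)) (P.vert (-k - 1 + 1))
    rw [c.symm]
    congr 2 <;> ring
  have h2 : ∀ k : ZMod P.n, turnSign (P.reverse.ty c k) (P.reverse.ty c (k + 1 : ZMod P.n)) =
      -turnSign (P.ty c (-k - 2)) (P.ty c (-k - 2 + 1)) := by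
    intro k
    rw [h1, h1 (k + 1), ← turnSign_swap _ _ (P.ty_ne c _)]
    congr 2 <;> ring
  change ∏ k : ZMod P.n, turnSign (P.reverse.ty c k) (P.reverse.ty c (k + 1 : ZMod P.n)) = _
  rw [Finset.prod_congr rfl fun k _ => h2 k, Finset.prod_neg, Finset.card_univ, ZMod.card, hn.neg_one_pow, one_mul]
  exact Equiv.prod_comp ((Equiv.neg (ZMod P.n)).trans (Equiv.subRight 2))
    (fun k => turnSign (P.ty c k) (P.ty c (k + 1)))

/-- Every loop of a double dimer configuration has an even number of right turns. -/
theorem LoopParam.prod_turnSign {D : DoubleDimer G} (P : LoopParam D) (c : EdgeColoring G)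
    (side : V → Bool) (hs : ∀ u v, G.Adj u v → side u ≠ side v)
    (hG : Coherent G side) (hG' : Coherent (squish G c) (squishSide side)) :
    ∏ k, turnSign (P.ty c k) (P.ty c (k + 1)) = 1 := by
  obtain ⟨f, hf⟩ := D.exists_matching side hs
  -- The normalized case: at some left vertex the edge of `f` is the incoming one. Then the edges of
  -- the loop alternate all the way round, since `f` uses an edge of `D` at every vertex and a loop
  -- contains both edges of `D` at its vertices.
  have key : ∀ (P : LoopParam D) (k₀ : ZMod P.n), side (P.vert k₀) = true →
      f.1 (P.vert k₀) = P.vert (k₀ - 1) → ∏ k, turnSign (P.ty c k) (P.ty c (k + 1)) = 1 := by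
    intro P k₀ hk₀ hfk₀
    obtain ⟨m, hm⟩ := P.even_n side hs
    have h3 := P.three_le
    have hstep : ∀ k, f.1 (P.vert k) = P.vert (k - 1) → f.1 (P.vert (k + 1)) = P.vert (k + 2) := by
      intro k hk
      rcases P.mult_vert (k + 1) _ (hf _) with h | h
      · rw [h, add_assoc, one_add_one_eq_two]
      · rw [add_sub_cancel_right] at h
        rw [← h, f.2.2] at hk
        exact absurd hk (P.vert_succ_ne k)
    have hall : ∀ j : ℕ, f.1 (P.vert (k₀ + (2 * j : ℕ))) = P.vert (k₀ + (2 * j : ℕ) - 1) := by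
      intro j
      induction j with
      | zero => simpa using hfk₀
      | succ j ih =>
        have h1 := hstep _ ih
        have e1 : k₀ + ((2 * (j + 1) : ℕ) : ZMod P.n) = k₀ + ((2 * j : ℕ) : ZMod P.n) + 2 := by
          push_cast; ring
        rw [e1, ← h1, f.2.2]
        congr 1
        ring
    have hmain := prod_turnSign_of_alternating (c := c) side hs hG hG' f
      (u := fun j => P.vert (k₀ + (j : ℕ))) (m := m) (by omega) ?_ ?_ ?_ ?_ ?_ (by simpa using hk₀)
    · rw [show 2 * m = P.n by omega] at hmain
      rw [← hmain, ← Equiv.prod_comp (Equiv.addLeft k₀), ← prod_range_eq_prod_zmod P.n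
        (fun k => turnSign (P.ty c ((Equiv.addLeft k₀) k)) (P.ty c ((Equiv.addLeft k₀) k + 1)))]
      refine Finset.prod_congr rfl fun j _ => ?_
      unfold LoopParam.ty
      simp only [Equiv.coe_addLeft, Nat.cast_add, Nat.cast_one, Nat.cast_ofNat, add_assoc,
        one_add_one_eq_two]
    · intro j
      simp only [show j + 2 * m = j + P.n by omega, Nat.cast_add, ZMod.natCast_self, add_zero]
    · intro a b ha hb h
      have h1 := P.inj h
      push_cast at h1
      have h2 : (a : ZMod P.n) = b := by linear_combination h1
      have := congrArg ZMod.val h2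
      rwa [ZMod.val_natCast_of_lt (by omega), ZMod.val_natCast_of_lt (by omega)] at this
    · intro j
      have := P.adj (k₀ + (j : ℕ))
      rw [add_assoc] at this
      simpa using this
    · intro j
      have := P.ty_ne c (k₀ + (j : ℕ))
      unfold LoopParam.ty at this
      simpa only [Nat.cast_add, Nat.cast_one, Nat.cast_ofNat, add_assoc,
        one_add_one_eq_two] using this
    · intro j
      have := hstep _ (hall j)
      simpa only [Nat.cast_add, Nat.cast_one, Nat.cast_ofNat, add_assoc] using this
  obtain ⟨k₀, hk₀⟩ : ∃ k, side (P.vert k) = true := by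
    by_contra h
    push Not at h
    have h1 := hs _ _ (P.adj 0)
    have h2 := h 0
    have h3 := h (0 + 1)
    simp only [Bool.not_eq_true] at h2 h3
    rw [h2, h3] at h1
    exact h1 rfl
  -- If the edge of `f` at `k₀` is the outgoing one, the reversed loop is in the normalized case.
  rcases P.mult_vert k₀ _ (hf _) with h | h
  · rw [← P.prod_turnSign_reverse c (P.even_n side hs)]
    refine key P.reverse (show ZMod P.n from -k₀) ?_ ?_
    · change side (P.vert (- -k₀)) = true
      rwa [neg_neg]
    · change f.1 (P.vert (- -k₀)) = P.vert (-(-k₀ - 1))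
      rw [neg_neg, h]
      congr 1
      ring
  · exact key P k₀ hk₀ h

end

/-! ### The refined honeycomb graph is a squished graph -/

/-- The colours of the honeycomb edges: `0` for horizontal, `1` for north-east and `2` for
north-west edges. -/
def hexTy : HVertex → HVertex → ZMod 3
  | .left i j, .right k l => if (k, l) = (i, j) then 0 else if (k, l) = (i + 1, j) then 1 else 2
  | .right k l, .left i j => if (k, l) = (i, j) then 0 else if (k, l) = (i + 1, j) then 1 else 2
  | _, _ => 0

theorem hexTy_comm (u v : HVertex) : hexTy u v = hexTy v u := by
  rcases u with ⟨i, j⟩ | ⟨i, j⟩ <;> rcases v with ⟨k, l⟩ | ⟨k, l⟩ <;> rfl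

theorem hexTy_horizontal (i j : ℤ) : hexTy (.left i j) (.right i j) = 0 := by
  simp [hexTy]

theorem hexTy_northEast (i j : ℤ) : hexTy (.left i j) (.right (i + 1) j) = 1 := by
  simp [hexTy]

theorem hexTy_northWest (i j : ℤ) : hexTy (.left i j) (.right i (j - 1)) = 2 := by
  simp [hexTy]

theorem honeycomb_left_adj {i j : ℤ} {v : HVertex} (h : honeycomb.Adj (.left i j) v) :
    v = .right i j ∨ v = .right (i + 1) j ∨ v = .right i (j - 1) := by
  rcases v with ⟨k, l⟩ | ⟨k, l⟩
  · exact h.elim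
  · have h' : (k, l) = (i, j) ∨ (k, l) = (i + 1, j) ∨ (k, l) = (i, j - 1) := h
    simpa only [HVertex.right.injEq, Prod.mk.injEq] using h'

theorem honeycomb_right_adj {i j : ℤ} {v : HVertex} (h : honeycomb.Adj (.right i j) v) :
    v = .left i j ∨ v = .left (i - 1) j ∨ v = .left i (j + 1) := by
  rcases v with ⟨k, l⟩ | ⟨k, l⟩
  · have h' : (i, j) = (k, l) ∨ (i, j) = (k + 1, l) ∨ (i, j) = (k, l - 1) := h
    simp only [HVertex.left.injEq, Prod.mk.injEq] at h' ⊢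
    omega
  · exact h.elim

theorem hexTy_inj (u v w : HVertex) (hv : honeycomb.Adj u v) (hw : honeycomb.Adj u w)
    (h : hexTy u v = hexTy u w) : v = w := by
  rcases u with ⟨i, j⟩ | ⟨i, j⟩
  · rcases honeycomb_left_adj hv with rfl | rfl | rfl <;>
      rcases honeycomb_left_adj hw with rfl | rfl | rfl <;>
      simp only [hexTy_horizontal, hexTy_northEast, hexTy_northWest] at h <;>
      first
      | rfl
      | exact absurd h (by decide)
  · have e1 : hexTy (.right i j) (.left (i - 1) j) = 1 := by
      have := hexTy_northEast (i - 1) j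
      rwa [sub_add_cancel, hexTy_comm] at this
    have e2 : hexTy (.right i j) (.left i (j + 1)) = 2 := by simp [hexTy]
    have e0 : hexTy (.right i j) (.left i j) = 0 := by simp [hexTy]
    rcases honeycomb_right_adj hv with rfl | rfl | rfl <;>
      rcases honeycomb_right_adj hw with rfl | rfl | rfl <;>
      simp only [e0, e1, e2] at h <;>
      first
      | rfl
      | exact absurd h (by decide)

/-- The edge colouring of the honeycomb graph by directions. -/
def hexColoring (x y z : ℕ) : EdgeColoring (hexGraph x y z) where
  ty u v := hexTy u.1 v.1
  symm _ _ := hexTy_comm _ _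
  inj _ _ _ hv hw h := Subtype.ext (hexTy_inj _ _ _ hv hw h)

/-- The triangle of the refined lattice for the centre or a leaf of a triangle. -/
def refine : HVertex → Option (ZMod 3) → HVertex
  -- The middle one of the four small triangles has the opposite orientation. The leaf of colour `x`
  -- is the small triangle at the corner opposite to the side crossed by the edge of colour `x`.
  | .left i j, none => .right (2 * i + 1) (2 * j)
  | .left i j, some x => if x = 0 then .left (2 * i + 1) (2 * j)
      else if x = 1 then .left (2 * i) (2 * j) else .left (2 * i + 1) (2 * j + 1)
  | .right i j, none => .left (2 * i) (2 * j + 1)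
  | .right i j, some x => if x = 0 then .right (2 * i) (2 * j + 1)
      else if x = 1 then .right (2 * i + 1) (2 * j + 1) else .right (2 * i) (2 * j)

section

variable (i j : ℤ)

theorem refine_left_none : refine (.left i j) none = .right (2 * i + 1) (2 * j) := rfl
theorem refine_left_zero : refine (.left i j) (some 0) = .left (2 * i + 1) (2 * j) := rfl
theorem refine_left_one : refine (.left i j) (some 1) = .left (2 * i) (2 * j) := rfl
theorem refine_left_two : refine (.left i j) (some 2) = .left (2 * i + 1) (2 * j + 1) := rfl
theorem refine_right_none : refine (.right i j) none = .left (2 * i) (2 * j + 1) := rfl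
theorem refine_right_zero : refine (.right i j) (some 0) = .right (2 * i) (2 * j + 1) := rfl
theorem refine_right_one : refine (.right i j) (some 1) = .right (2 * i + 1) (2 * j + 1) := rfl
theorem refine_right_two : refine (.right i j) (some 2) = .right (2 * i) (2 * j) := rfl

end

theorem option_cases (o : Option (ZMod 3)) : o = none ∨ o = some 0 ∨ o = some 1 ∨ o = some 2 := by
  revert o; decide

theorem refine_mem (x y z : ℕ) (v : HVertex) (o : Option (ZMod 3)) :
    refine v o ∈ boxVertices (2 * x) (2 * y) (2 * z) ↔ v ∈ boxVertices x y z := by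
  rcases v with ⟨i, j⟩ | ⟨i, j⟩ <;> rcases option_cases o with rfl | rfl | rfl | rfl <;>
    simp only [refine_left_none, refine_left_zero, refine_left_one, refine_left_two,
      refine_right_none, refine_right_zero, refine_right_one, refine_right_two,
      left_mem_boxVertices, right_mem_boxVertices] <;> push_cast <;> omega

theorem refine_injective (v v' : HVertex) (o o' : Option (ZMod 3))
    (h : refine v o = refine v' o') : v = v' ∧ o = o' := by
  rcases v with ⟨i, j⟩ | ⟨i, j⟩ <;> rcases v' with ⟨k, l⟩ | ⟨k, l⟩ <;>
    rcases option_cases o with rfl | rfl | rfl | rfl <;>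
    rcases option_cases o' with rfl | rfl | rfl | rfl <;>
    simp only [refine_left_none, refine_left_zero, refine_left_one, refine_left_two,
      refine_right_none, refine_right_zero, refine_right_one, refine_right_two,
      HVertex.left.injEq, HVertex.right.injEq, reduceCtorEq] at h ⊢ <;>
    first
    | omega
    | (refine ⟨by omega, trivial⟩)

theorem refine_surjective (u : HVertex) : ∃ v o, refine v o = u := by
  rcases u with ⟨I, J⟩ | ⟨I, J⟩ <;> rcases Int.even_or_odd' I with ⟨i, rfl | rfl⟩ <;>
    rcases Int.even_or_odd' J with ⟨j, rfl | rfl⟩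
  · exact ⟨.left i j, some 1, rfl⟩
  · exact ⟨.right i j, none, rfl⟩
  · exact ⟨.left i j, some 0, rfl⟩
  · exact ⟨.left i j, some 2, rfl⟩
  · exact ⟨.right i j, some 2, rfl⟩
  · exact ⟨.right i j, some 0, rfl⟩
  · exact ⟨.left i j, none, rfl⟩
  · exact ⟨.right i j, some 1, rfl⟩

theorem honeycomb_left_right (i j k l : ℤ) : honeycomb.Adj (.left i j) (.right k l) ↔
    (k = i ∧ l = j) ∨ (k = i + 1 ∧ l = j) ∨ (k = i ∧ l = j - 1) := by
  simp only [← Prod.mk.injEq]; rfl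

theorem refine_adj_left_right (i j k l : ℤ) (x y : ZMod 3) :
    honeycomb.Adj (refine (.left i j) (some x)) (refine (.right k l) (some y)) ↔
      honeycomb.Adj (.left i j) (.right k l) ∧ x ≠ hexTy (.left i j) (.right k l) ∧
        y ≠ hexTy (.left i j) (.right k l) ∧ x ≠ y := by
  have h1 : (honeycomb.Adj (.left i j) (.right k l) ∧ x ≠ hexTy (.left i j) (.right k l) ∧
        y ≠ hexTy (.left i j) (.right k l) ∧ x ≠ y) ↔
      ((k = i ∧ l = j) ∧ x ≠ 0 ∧ y ≠ 0 ∧ x ≠ y) ∨ ((k = i + 1 ∧ l = j) ∧ x ≠ 1 ∧ y ≠ 1 ∧ x ≠ y) ∨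
        ((k = i ∧ l = j - 1) ∧ x ≠ 2 ∧ y ≠ 2 ∧ x ≠ y) := by
    rw [honeycomb_left_right]
    constructor
    · rintro ⟨⟨rfl, rfl⟩ | ⟨rfl, rfl⟩ | ⟨rfl, rfl⟩, h⟩
      · rw [hexTy_horizontal] at h; exact Or.inl ⟨⟨rfl, rfl⟩, h⟩
      · rw [hexTy_northEast] at h; exact Or.inr (Or.inl ⟨⟨rfl, rfl⟩, h⟩)
      · rw [hexTy_northWest] at h; exact Or.inr (Or.inr ⟨⟨rfl, rfl⟩, h⟩)
    · rintro (⟨⟨rfl, rfl⟩, h⟩ | ⟨⟨rfl, rfl⟩, h⟩ | ⟨⟨rfl, rfl⟩, h⟩)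
      · rw [hexTy_horizontal]; exact ⟨Or.inl ⟨rfl, rfl⟩, h⟩
      · rw [hexTy_northEast]; exact ⟨Or.inr (Or.inl ⟨rfl, rfl⟩), h⟩
      · rw [hexTy_northWest]; exact ⟨Or.inr (Or.inr ⟨rfl, rfl⟩), h⟩
  rw [h1]
  have d01 : (0 : ZMod 3) ≠ 1 := by decide
  have d02 : (0 : ZMod 3) ≠ 2 := by decide
  have d12 : (1 : ZMod 3) ≠ 2 := by decide
  rcases zmod_three_cases x with rfl | rfl | rfl <;>
    rcases zmod_three_cases y with rfl | rfl | rfl <;>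
    simp only [refine_left_zero, refine_left_one, refine_left_two, refine_right_zero,
      refine_right_one, refine_right_two, honeycomb_left_right, ne_eq, d01, d02, d12, d01.symm,
      d02.symm, d12.symm, not_true_eq_false, not_false_eq_true, and_true, and_false,
      or_false, false_or, iff_false] <;> omega

theorem refine_adj (x y z : ℕ) (a b : boxVertices x y z × Option (ZMod 3)) :
    honeycomb.Adj (refine a.1.1 a.2) (refine b.1.1 b.2) ↔
      (squish (hexGraph x y z) (hexColoring x y z)).Adj a b := by
  have hcen : ∀ (v v' : HVertex) (s : ZMod 3),
      honeycomb.Adj (refine v none) (refine v' (some s)) ↔ v = v' := by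
    intro v v' s
    rcases v with ⟨i, j⟩ | ⟨i, j⟩ <;> rcases v' with ⟨k, l⟩ | ⟨k, l⟩ <;>
      rcases zmod_three_cases s with rfl | rfl | rfl <;>
      simp only [refine_left_none, refine_left_zero, refine_left_one, refine_left_two,
        refine_right_none, refine_right_zero, refine_right_one, refine_right_two,
        HVertex.left.injEq, HVertex.right.injEq, reduceCtorEq] <;>
      first
      | (rw [honeycomb_left_right]; omega)
      | (rw [SimpleGraph.adj_comm, honeycomb_left_right]; omega)
      | exact Iff.rfl
  obtain ⟨⟨v, hv⟩, _ | s⟩ := a <;> obtain ⟨⟨v', hv'⟩, _ | s'⟩ := b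
  · change _ ↔ False
    rcases v with ⟨i, j⟩ | ⟨i, j⟩ <;> rcases v' with ⟨k, l⟩ | ⟨k, l⟩ <;>
      simp only [refine_left_none, refine_right_none]
    · exact Iff.rfl
    · rw [SimpleGraph.adj_comm, honeycomb_left_right, iff_false]; omega
    · rw [honeycomb_left_right, iff_false]; omega
    · exact Iff.rfl
  · refine (hcen v v' s').trans ?_
    change _ ↔ (⟨v, hv⟩ : boxVertices x y z) = ⟨v', hv'⟩
    rw [Subtype.mk.injEq]
  · rw [SimpleGraph.adj_comm]
    refine (hcen v' v s).trans ?_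
    change _ ↔ (⟨v, hv⟩ : boxVertices x y z) = ⟨v', hv'⟩
    rw [Subtype.mk.injEq]
    exact eq_comm
  · change _ ↔ honeycomb.Adj v v' ∧ s ≠ hexTy v v' ∧ s' ≠ hexTy v v' ∧ s ≠ s'
    rcases v with ⟨i, j⟩ | ⟨i, j⟩ <;> rcases v' with ⟨k, l⟩ | ⟨k, l⟩
    · have : ¬ honeycomb.Adj (refine (.left i j) (some s)) (refine (.left k l) (some s')) := by
        intro h
        rcases zmod_three_cases s with rfl | rfl | rfl <;>
          rcases zmod_three_cases s' with rfl | rfl | rfl <;> exact h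
      exact ⟨fun h => absurd h this, fun h => h.1.elim⟩
    · exact refine_adj_left_right i j k l s s'
    · rw [SimpleGraph.adj_comm, refine_adj_left_right, SimpleGraph.adj_comm, hexTy_comm]
      tauto
    · have : ¬ honeycomb.Adj (refine (.right i j) (some s)) (refine (.right k l) (some s')) := by
        intro h
        rcases zmod_three_cases s with rfl | rfl | rfl <;>
          rcases zmod_three_cases s' with rfl | rfl | rfl <;> exact h
      exact ⟨fun h => absurd h this, fun h => h.1.elim⟩

/-- The squished honeycomb graph is the refined honeycomb graph. -/
def squishIso (x y z : ℕ) :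
    squish (hexGraph x y z) (hexColoring x y z) ≃g hexGraph (2 * x) (2 * y) (2 * z) where
  toEquiv := Equiv.ofBijective (fun a => ⟨refine a.1.1 a.2, (refine_mem x y z _ _).2 a.1.2⟩) (by
    constructor
    · rintro ⟨⟨v, hv⟩, o⟩ ⟨⟨v', hv'⟩, o'⟩ h
      obtain ⟨rfl, rfl⟩ := refine_injective _ _ _ _ (congrArg Subtype.val h)
      rfl
    · rintro ⟨u, hu⟩
      obtain ⟨v, o, rfl⟩ := refine_surjective u
      exact ⟨(⟨v, (refine_mem x y z v o).1 hu⟩, o), rfl⟩)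
  map_rel_iff' {a b} := refine_adj x y z a b

theorem squishIso_apply (x y z : ℕ) (a : boxVertices x y z × Option (ZMod 3)) :
    (squishIso x y z a).1 = refine a.1.1 a.2 := rfl

theorem hexSide_refine (v : HVertex) (o : Option (ZMod 3)) :
    hexSide (refine v o) = squishSide hexSide (v, o) := by
  rcases v with ⟨i, j⟩ | ⟨i, j⟩ <;> rcases option_cases o with rfl | rfl | rfl | rfl <;> rfl

/-- The squished graph is again a hexagon graph, so the sign argument applies to it as well; the
parity of right turns comes from comparing the two. -/
theorem squish_hexGraph_coherent (x y z : ℕ) :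
    Coherent (squish (hexGraph x y z) (hexColoring x y z))
      (squishSide fun v => hexSide v.1) := by
  have := (hexGraph_coherent (2 * x) (2 * y) (2 * z)).congr (squishIso x y z)
  convert this using 1
  funext ⟨v, o⟩
  rw [squishIso_apply, hexSide_refine]
  cases o <;> rfl

/-! ### Weights and connection -/

/-- The diagonal of the matrix of a step. -/
def stepDiag (a b c : ℂˣ) : HVertex → HVertex → Fin 2 → ℂ
  | .left i j, .right k l, s =>
      if (k, l) = (i, j) then matA a s s
      -- Going from a left to a right vertex along a north-east edge means walking south-west,
      -- against the reference direction, which exchanges the two strands. For the other two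
      -- directions this happens in going from right to left.
      else if (k, l) = (i + 1, j) then matB b (1 - s) (1 - s) else matC c s s
  | .right k l, .left i j, s =>
      if (k, l) = (i, j) then matA a (1 - s) (1 - s)
      else if (k, l) = (i + 1, j) then matB b s s else matC c (1 - s) (1 - s)
  | _, _, _ => 1

theorem stepDiag_swap (a b c : ℂˣ) (u v : HVertex) (s : Fin 2) :
    stepDiag a b c v u (1 - s) = stepDiag a b c u v s := by
  rcases u with ⟨i, j⟩ | ⟨i, j⟩ <;> rcases v with ⟨k, l⟩ | ⟨k, l⟩ <;>
    simp only [stepDiag, Fin.two_sub_sub]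

theorem stepDiag_mul (a b c : ℂˣ) (u v : HVertex) :
    stepDiag a b c u v 0 * stepDiag a b c u v 1 = 1 := by
  rcases u with ⟨i, j⟩ | ⟨i, j⟩ <;> rcases v with ⟨k, l⟩ | ⟨k, l⟩ <;>
    simp only [stepDiag, mul_one] <;> split_ifs <;> simp [matA, matB, matC]

theorem honeycombWeight_left_right (A B C : Matrix (Fin 2) (Fin 2) ℂ) (i j k l : ℤ) :
    honeycombWeight A B C s(.left i j, .right k l) = edgeWeight A B C i j k l := rfl

theorem honeycombWeight_right_left (A B C : Matrix (Fin 2) (Fin 2) ℂ) (i j k l : ℤ) :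
    honeycombWeight A B C s(.right k l, .left i j) = edgeWeight A B C i j k l := rfl

theorem not_odd_two_mul (n : ℤ) : ¬ Odd (2 * n) :=
  Int.not_odd_iff_even.2 (even_two_mul n)

/-- The two hexagons beside such an edge are midpoints of sides of an original triangle, hence not
even. -/
theorem honeycombWeight_center (A B C : Matrix (Fin 2) (Fin 2) ℂ) (v : HVertex) (x : ZMod 3) :
    honeycombWeight A B C s(refine v (some x), refine v none) = 1 := by
  rcases v with ⟨i, j⟩ | ⟨i, j⟩ <;> rcases zmod_three_cases x with rfl | rfl | rfl <;>
    simp only [refine_left_none, refine_left_zero, refine_left_one, refine_left_two,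
      refine_right_none, refine_right_zero, refine_right_one, refine_right_two,
      honeycombWeight_left_right, honeycombWeight_right_left, edgeWeight, strandWeight] <;>
    simp [not_odd_two_mul]

/-- The two leaf triangles of a strand share a corner that is a point of the original lattice, an
even hexagon. It lies to the left of strand 0 and to the right of strand 1. -/
theorem honeycombWeight_strand (a b c : ℂˣ) (u v : HVertex) (h : honeycomb.Adj u v) (s : Fin 2) :
    honeycombWeight (matA a) (matB b) (matC c)
      s(refine u (some (leaf (hexTy u v) s)), refine v (some (leaf (hexTy u v) (1 - s)))) =
      stepDiag a b c u v s := by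
  have key : ∀ i j v, honeycomb.Adj (.left i j) v → ∀ s,
      honeycombWeight (matA a) (matB b) (matC c)
        s(refine (.left i j) (some (leaf (hexTy (.left i j) v) s)),
          refine v (some (leaf (hexTy (.left i j) v) (1 - s)))) =
      stepDiag a b c (.left i j) v s := by
    intro i j v h s
    have l00 : leaf 0 0 = 1 := rfl
    have l01 : leaf 0 1 = 2 := rfl
    have l10 : leaf 1 0 = 2 := rfl
    have l11 : leaf 1 1 = 0 := rfl
    have l20 : leaf 2 0 = 0 := rfl
    have l21 : leaf 2 1 = 1 := rfl
    rcases honeycomb_left_adj h with rfl | rfl | rfl <;>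
      simp only [hexTy_horizontal, hexTy_northEast, hexTy_northWest] <;>
      fin_cases s <;>
      simp only [Fin.zero_eta, Fin.mk_one, sub_zero, sub_self, l00, l01, l10, l11, l20, l21,
        refine_left_zero, refine_left_one, refine_left_two, refine_right_zero, refine_right_one,
        refine_right_two, honeycombWeight_left_right, edgeWeight, strandWeight, stepDiag] <;>
      simp [not_odd_two_mul, matA, matB, matC] <;>
      (split_ifs <;> first | rfl | omega)
  rcases u with ⟨i, j⟩ | ⟨i, j⟩
  · exact key i j v h s
  · rcases v with ⟨k, l⟩ | ⟨k, l⟩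
    · have := key k l _ h.symm (1 - s)
      rw [stepDiag_swap, Fin.two_sub_sub, hexTy_comm, Sym2.eq_swap] at this
      exact this
    · exact h.elim

theorem alpha_coe (a : ℂˣ) : (alpha a : Matrix (Fin 2) (Fin 2) ℂ) =
    !![Complex.I * a, 0; 0, -(Complex.I * (a : ℂ)⁻¹)] := by
  simp [alpha, matA, matJ]

theorem beta_coe (b : ℂˣ) : (beta b : Matrix (Fin 2) (Fin 2) ℂ) =
    !![Complex.I * b, -(Complex.I * (b + (b : ℂ)⁻¹)); 0, -(Complex.I * (b : ℂ)⁻¹)] := by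
  simp [beta, matB, matL, matR, matJ]
  ring

theorem gamma_coe (c : ℂˣ) : (gamma c : Matrix (Fin 2) (Fin 2) ℂ) =
    !![-(Complex.I * (c : ℂ)⁻¹), 0; -(Complex.I * (c + (c : ℂ)⁻¹)), Complex.I * c] := by
  simp [gamma, matC, matL, matR, matJ]

/-- The gauge transformation of the connection. -/
theorem stepMatrix_eq (a b c : ℂˣ) (u v : HVertex) (h : honeycomb.Adj u v) :
    (stepMatrix (alpha a) (beta b) (gamma c) u v : Matrix (Fin 2) (Fin 2) ℂ) =
      (if hexSide u = true then Complex.I else -Complex.I) • (gauge (-hexTy u v) *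
        (matJ * Matrix.diagonal (stepDiag a b c u v)) * gauge (hexTy u v)) := by
  have hd : ∀ m : Fin 2 → ℂ, Matrix.diagonal m = !![m 0, 0; 0, m 1] := by
    intro m; ext i j; fin_cases i <;> fin_cases j <;> rfl
  have n1 : (-1 : ZMod 3) = 2 := rfl
  have n2 : (-2 : ZMod 3) = 1 := rfl
  have hinv : ∀ g : Matrix.SpecialLinearGroup (Fin 2) ℂ, ((g⁻¹ : Matrix.SpecialLinearGroup (Fin 2) ℂ)
      : Matrix (Fin 2) (Fin 2) ℂ) = !![g.1 1 1, -g.1 0 1; -g.1 1 0, g.1 0 0] := fun g => by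
    rw [Matrix.SpecialLinearGroup.coe_inv, Matrix.adjugate_fin_two]
  rcases u with ⟨i, j⟩ | ⟨i, j⟩
  · rcases honeycomb_left_adj h with rfl | rfl | rfl
    · rw [hexTy_horizontal, show stepMatrix (alpha a) (beta b) (gamma c) (.left i j) (.right i j) =
        alpha a by simp [stepMatrix], alpha_coe]
      simp [hexSide, gauge_zero, hd, stepDiag, matJ, matA]
    · rw [hexTy_northEast, n1, gauge_one, gauge_two, show stepMatrix (alpha a) (beta b) (gamma c)
        (.left i j) (.right (i + 1) j) = (beta b)⁻¹ by simp [stepMatrix], hinv, beta_coe]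
      simp [hexSide, hd, stepDiag, matJ, matB]
    · rw [hexTy_northWest, n2, gauge_one, gauge_two, show stepMatrix (alpha a) (beta b) (gamma c)
        (.left i j) (.right i (j - 1)) = gamma c by simp [stepMatrix], gamma_coe]
      simp [hexSide, hd, stepDiag, matJ, matC]
      ring
  · rcases honeycomb_right_adj h with rfl | rfl | rfl
    · rw [hexTy_comm, hexTy_horizontal, show stepMatrix (alpha a) (beta b) (gamma c)
        (.right i j) (.left i j) = (alpha a)⁻¹ by simp [stepMatrix], hinv, alpha_coe]
      simp [hexSide, gauge_zero, hd, stepDiag, matJ, matA]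
    · obtain ⟨k, rfl⟩ : ∃ k, i = k + 1 := ⟨i - 1, by ring⟩
      rw [add_sub_cancel_right, hexTy_comm, hexTy_northEast, n1, gauge_one, gauge_two,
        show stepMatrix (alpha a) (beta b) (gamma c) (.right (k + 1) j) (.left k j) = beta b by
          simp [stepMatrix], beta_coe]
      simp [hexSide, hd, stepDiag, matJ, matB]
      ring
    · obtain ⟨k, rfl⟩ : ∃ k, j = k - 1 := ⟨j + 1, by ring⟩
      rw [sub_add_cancel, hexTy_comm, hexTy_northWest, n2, gauge_one, gauge_two,
        show stepMatrix (alpha a) (beta b) (gamma c) (.right i (k - 1)) (.left i k) = (gamma c)⁻¹ by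
          simp [stepMatrix], hinv, gamma_coe]
      simp [hexSide, hd, stepDiag, matJ, matC]
      ring

end Squish

end

/-! ### The theorem for the hexagon graphs -/

theorem mainTheorem2 (x y z : ℕ) (a b c : ℂˣ) :
    Squish.dimerPartition (Squish.hexGraph (2 * x) (2 * y) (2 * z))
        (Squish.hexWeight (2 * x) (2 * y) (2 * z)
          (Squish.matA a) (Squish.matB b) (Squish.matC c)) =
      Squish.doubleDimerPartition (Squish.hexGraph x y z) (fun _ => 1)
        (Squish.hexConnection x y z (Squish.alpha a) (Squish.beta b) (Squish.gamma c)) := by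
  have hs := Squish.hexGraph_side x y z
  rw [← Squish.dimerPartition_congr (Squish.squishIso x y z) (fun e =>
    Squish.hexWeight (2 * x) (2 * y) (2 * z) (Squish.matA a) (Squish.matB b) (Squish.matC c)
      (e.map (Squish.squishIso x y z))) _ (fun v => Squish.hexSide v.1)
    (Squish.hexGraph_side _ _ _) (fun _ _ _ => rfl)]
  refine Squish.dimerPartition_squish (fun v => Squish.hexSide v.1) hs _ ?_
    (fun u v => Squish.stepDiag a b c u.1 v.1) ?_ ?_ _ ?_ ?_
  · intro u t
    exact Squish.honeycombWeight_center _ _ _ u.1 t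
  · intro u v s h
    exact Squish.honeycombWeight_strand a b c u.1 v.1 h s
  · intro u v _
    exact Squish.stepDiag_mul a b c u.1 v.1
  · intro d
    exact Squish.stepMatrix_eq a b c _ _ d.adj
  · intro D P
    exact P.prod_turnSign _ _ hs (Squish.hexGraph_coherent x y z)
      (Squish.squish_hexGraph_coherent x y z)
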